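/- \textbf{Setting.} A prediction algorithm is a family $(\mathcal A_{p,n})_{p,n\in\mathbb N}$ of Borel measurable functions $\mathcal A_{p,n}:\mathbb R^p\times(\mathbb R\times\mathbb R^p)^n\to\mathbb R$; it is symmetric if $\mathcal A_{p,n}(x,T)$ is invariant under permutations of the $n$ entries of $T$, for all $p,n,x,T$. For every $n\ge 2$ let $p_n\in\mathbb N$, let $\mathcal P_n$ be a Borel probability measure on $\mathbb R\times\mathbb R^{p_n}$, and let $(y_i,x_i)=(y_i^{(n)},x_i^{(n)})$, $1\le i\le n+1$, be i.i.d. pairs with law $\mathcal P_n$, defined on a probability space that may depend on $n$. Put $T_n=(y_i,x_i)_{i=1}^n$, and let $T_n^{\setminus i}$ be $T_n$ with its $i$-th pair removed. Define $$\hat y_{n+1}=\mathcal A_{p_n,n}(x_{n+1},T_n),\qquad \hat y_j^{\setminus i}=\mathcal A_{p_n,n-1}(x_j,T_n^{\setminus i}),\qquad \hat u_i=y_i-\hat y_i^{\setminus i}.$$ The predictor is called \emph{stable} if $\lim_{n\to\infty}\frac1n\sum_{i=1}^n\mathbb P(|\hat y_{n+1}-\hat y_{n+1}^{\setminus i}|\ge\epsilon)=0$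 for every $\epsilon>0$. \textbf{(i) Conditional risk.} Assume the predictor is stable and the sequence of prediction errors $y_{n+1}-\hat y_{n+1}$, $n\ge2$, is bounded in probability. Let $\ell:\mathbb R\to\mathbb R$ be non-decreasing such that the sequences $\ell(|y_{n+1}-\hat y_{n+1}|)$ and $\ell(|y_{n+1}-\hat y_{n+1}^{\setminus n}|)$, $n\ge2$, are uniformly integrable. Then for every $\epsilon>0$ $$\lim_{n\to\infty}\mathbb P\Big(\frac1n\sum_{i=1}^n\ell(|\hat u_i|-\epsilon)-\epsilon\ \le\ \mathbb E\big(\ell(|y_{n+1}-\hat y_{n+1}|)\,\big|\,T_n\big)\ \le\ \frac1n\sum_{i=1}^n\ell(|\hat u_i|+\epsilon)+\epsilon\Big)=1.$$ \textbf{(ii) Conditional mean-squared prediction error.} Assume the predictor is stable and, for some $\xi>0$, the $(2+\xi)$-th absolute moments of $y_{n+1}-\hat y_{n+1}$ and of $y_{n+1}-\hat y_{n+1}^{\setminus n}$ are bounded uniformly over $n\ge2$. Then $$\lim_{n\to\infty}\mathbb E\Big|\mathbb E\big((y_{n+1}-\hat y_{n+1})^2\,\big|\,T_n\big)-\frac1n\sum_{i=1}^n\hat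 u_i^2\Big|=0.$$ \textbf{(iii) Conditional misclassification error.} Let $K\in\mathbb N$ and assume that for every $n\ge2$ the variables $y_{n+1}$, $\hat y_{n+1}$ and $\hat y_{n+1}^{\setminus n}$ lie in $\{1,\dots,K\}$ almost surely. If the algorithm is symmetric and $\lim_{n\to\infty}\mathbb P(\hat y_{n+1}\ne\hat y_{n+1}^{\setminus n})=0$, then $$\lim_{n\to\infty}\mathbb E\Big|\mathbb P\big(y_{n+1}\ne\hat y_{n+1}\,\big|\,T_n\big)-\frac1n\sum_{i=1}^n\mathbf 1\{\hat u_i\ne0\}\Big|=0.$$ -/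

import Mathlib

open MeasureTheory ProbabilityTheory Filter Topology

/-- A response-feature pair `(y, x)` with `y : ℝ` and `x : ℝ^p`. -/
abbrev Obs (p : ℕ) : Type := ℝ × (Fin p → ℝ)

/-- A prediction algorithm: for every feature dimension `p` and sample size `n`, a map sending a
feature vector and a training sample of size `n` to a real prediction. -/
abbrev PredAlg : Type := ∀ p n : ℕ, (Fin p → ℝ) → (Fin n → Obs p) → ℝ

/-- Each `𝒜 p n` is Borel measurable jointly in the feature vector and the training sample. -/
def PredAlg.IsMeasurable (𝒜 : PredAlg) : Prop :=
  ∀ p n : ℕ, Measurable (Function.uncurry (𝒜 p n))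

/-- Permuting the training sample does not change the prediction. -/
def PredAlg.IsSymmetric (𝒜 : PredAlg) : Prop :=
  ∀ (p n : ℕ) (x : Fin p → ℝ) (T : Fin n → Obs p) (π : Equiv.Perm (Fin n)),
    𝒜 p n x (T ∘ π) = 𝒜 p n x T

/-- The sample `T` with its entry of (zero-based) index `i` removed, order preserved. -/
def dropObs {p n : ℕ} (i : ℕ) (T : Fin n → Obs p) : Fin (n - 1) → Obs p := fun j =>
  T ⟨if (j : ℕ) < i then j else j + 1, by have := j.isLt; split <;> omega⟩

/-- `Z 0, …, Z n` are i.i.d. random pairs with law `law`. -/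
structure IsIIDSample {Ω : Type*} [MeasurableSpace Ω] {p m : ℕ}
    (Z : Fin m → Ω → Obs p) (law : Measure (Obs p)) (P : Measure Ω) : Prop where
  measurable : ∀ i, Measurable (Z i)
  indep : iIndepFun Z P
  map_eq : ∀ i, P.map (Z i) = law

section Prediction

variable {Ω : Type*} {p n : ℕ}

/-- The training data `T_n`: the first `n` of the `n + 1` pairs. -/
def trainingData (Z : Fin (n + 1) → Ω → Obs p) (ω : Ω) : Fin n → Obs p :=
  fun i => Z i.castSucc ω

/-- The σ-algebra generated by the training data. -/
abbrev trainingSigma (Z : Fin (n + 1) → Ω → Obs p) : MeasurableSpace Ω :=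
  MeasurableSpace.comap (trainingData Z) inferInstance

/-- The new response `y_{n+1}`. -/
def newResponse (Z : Fin (n + 1) → Ω → Obs p) (ω : Ω) : ℝ := (Z (Fin.last n) ω).1

/-- The new feature vector `x_{n+1}`. -/
def newFeature (Z : Fin (n + 1) → Ω → Obs p) (ω : Ω) : Fin p → ℝ := (Z (Fin.last n) ω).2

/-- The predictor `ŷ_{n+1}` based on the full training data. -/
def fullPred (𝒜 : PredAlg) (Z : Fin (n + 1) → Ω → Obs p) (ω : Ω) : ℝ :=
  𝒜 p n (newFeature Z ω) (trainingData Z ω)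

/-- The leave-one-out predictor of `y_{n+1}`, with the training pair of zero-based index `i`
removed. The training pair called the `n`-th in one-based counting has index `n - 1`. -/
def looPred (𝒜 : PredAlg) (Z : Fin (n + 1) → Ω → Obs p) (i : ℕ) (ω : Ω) : ℝ :=
  𝒜 p (n - 1) (newFeature Z ω) (dropObs i (trainingData Z ω))

/-- The leave-one-out residual `û_i = y_i - ŷ_i^{∖i}`. -/
def looResidual (𝒜 : PredAlg) (Z : Fin (n + 1) → Ω → Obs p) (i : Fin n) (ω : Ω) : ℝ :=
  (trainingData Z ω i).1 -
    𝒜 p (n - 1) (trainingData Z ω i).2 (dropObs i (trainingData Z ω))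

end Prediction

section Sequences

variable {Ω : ℕ → Type*} [∀ n, MeasurableSpace (Ω n)]

/-- Stochastic boundedness of a sequence `(X n)_{n ≥ 2}` of random variables, where `X n` lives
on its own probability space. -/
def StochBounded (P : ∀ n, Measure (Ω n)) (X : ∀ n, Ω n → ℝ) : Prop :=
  ∀ ε : ℝ, 0 < ε → ∃ K : ℝ, ∀ n, 2 ≤ n → P n {ω | K < |X n ω|} ≤ ENNReal.ofReal ε

/-- Uniform integrability of a sequence `(X n)_{n ≥ 2}` of random variables, where `X n` lives
on its own probability space: `sup_n E(|X n| 1{|X n| ≥ M}) → 0` as `M → ∞`. -/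
def UnifIntegrableSeq (P : ∀ n, Measure (Ω n)) (X : ∀ n, Ω n → ℝ) : Prop :=
  ∀ ε : ℝ, 0 < ε → ∃ M : ℝ, ∀ n, 2 ≤ n →
    ∫⁻ ω in {ω | M ≤ |X n ω|}, ‖X n ω‖ₑ ∂(P n) ≤ ENNReal.ofReal ε

/-- The `q`-th absolute moments of `(X n)_{n ≥ 2}` are uniformly bounded. -/
def BoundedMoments (P : ∀ n, Measure (Ω n)) (X : ∀ n, Ω n → ℝ) (q : ℝ) : Prop :=
  ∃ C : NNReal, ∀ n, 2 ≤ n → ∫⁻ ω, ‖X n ω‖ₑ ^ q ∂(P n) ≤ C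

/-- Asymptotic out-of-sample stability: for all `ε > 0`,
`(1/n) ∑_i P(|ŷ_{n+1} - ŷ_{n+1}^{∖i}| ≥ ε) → 0`. -/
def IsOutOfSampleStable (𝒜 : PredAlg) (P : ∀ n, Measure (Ω n)) {p : ℕ → ℕ}
    (Z : ∀ n, Fin (n + 1) → Ω n → Obs (p n)) : Prop :=
  ∀ ε : ℝ, 0 < ε → Tendsto
    (fun n : ℕ => (1 / (n : ℝ)) *
      ∑ i : Fin n, (P n).real {ω | ε ≤ |fullPred 𝒜 (Z n) ω - looPred 𝒜 (Z n) i ω|})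
    atTop (𝓝 0)

end Sequences

/-!
The heart of the matter is a bound for a bounded loss `g` at a fixed sample size `n`. Write
`G (z, T)` for the loss at a point `z` of the predictor trained on a sample `T`, and `H i (z, T)` for
the loss of the predictor trained on `T` without its `i`-th entry. The conditional risk is
`R = ∫ G (z, T) dz`, the leave-one-out estimator is `S = n⁻¹ ∑ i, H i (T i, T)`, and stability
says that `δ i = E |G - H i|` is small on average. The second moment `E (R - S) ^ 2` is expanded.
With two fresh points `z, z'` one has `E R ^ 2 = E (G (z, T) * G (z', T))`. In the terms
`E (R * H i (T i, T))` and `E (H i (T i, T) * H j (T j, T))` the left-out sample points play the role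
of fresh points once they are replaced in `T` by `z` or `z'`: an exchange of a sample point with a
fresh point preserves the joint law, and each such replacement costs a bounded multiple of `δ i` or
`δ j`, because `H i` ignores the `i`-th entry of the sample
(`IsLeaveOneOutFamily.abs_cross_sub_le`, `IsLeaveOneOutFamily.abs_pair_sub_le`). Hence all terms with
`i ≠ j` agree up to the `δ`s, they cancel, and the diagonal contributes `O(1 / n)`
(`IsLeaveOneOutFamily.integral_abs_sampleRisk_sub_looRisk_le`). Only the stability at sample size
`n` enters: the predictor trained on `n - 2` points never occurs, which matters since the
observations at different `n` have unrelated laws. Symmetry of the algorithm is not needed either.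

For independent data the conditional expectation given the training data integrates out the new
observation (`condExp_comp_ae_eq_integral`), which transfers the bound to the prediction problem
(`IsIIDSample.lintegral_condExp_sub_le`). For a bounded Lipschitz loss, stability makes the average
of the `δ i` tend to zero (`tendsto_looRiskError_of_lipschitz`); for the zero-one loss and a
symmetric algorithm all `δ i` are at most the probability that removing the last point changes the
prediction (`tendsto_looRiskError_zeroOneLoss`).

The squared error is cut off at a fixed height, which leaves a bounded Lipschitz loss; the
remainders are uniformly small by the moment bounds, since every leave-one-out residual has the law of
`y_{n+1} - ŷ_{n+1}^{∖n}` (`tendsto_looRiskError_sq`). A monotone loss is clipped, and the clipped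
loss and its translate by `ε` are separated by a bounded Lipschitz function
(`Monotone.exists_lipschitzWith_between`), to which the bound applies; uniform integrability
controls the excess over the clipping height (`tendsto_measure_sandwich`).
-/

/-! ### Exchanging a sample point for a fresh one -/

theorem integrable_of_abs_le {α : Type*} [MeasurableSpace α] {μ : Measure α} [IsFiniteMeasure μ]
    {f : α → ℝ} {C : ℝ} (hf : Measurable f) (hC : ∀ x, |f x| ≤ C) : Integrable f μ :=
  Integrable.of_bound hf.aestronglyMeasurable C (Eventually.of_forall hC)

section Swap

variable {E : Type*} [MeasurableSpace E]

/-- Exchange a point with the `i`-th entry of a sample. -/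
def swapEntry {n : ℕ} (i : Fin n) (q : E × (Fin n → E)) : E × (Fin n → E) :=
  (q.2 i, Function.update q.2 i q.1)

/-- Exchange the first two components of a triple. -/
def swapFirstTwo {F : Type*} (q : E × (E × F)) : E × (E × F) := (q.2.1, (q.1, q.2.2))

variable (μ : Measure E) [IsProbabilityMeasure μ]

theorem measurePreserving_swapFirstTwo {F : Type*} [MeasurableSpace F] (ν : Measure F)
    [IsProbabilityMeasure ν] :
    MeasurePreserving (swapFirstTwo (E := E) (F := F)) (μ.prod (μ.prod ν)) (μ.prod (μ.prod ν)) :=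
  (measurePreserving_prodAssoc μ μ ν).comp
    (((Measure.measurePreserving_swap (μ := μ) (ν := μ)).prod (MeasurePreserving.id ν)).comp
      (measurePreserving_prodAssoc μ μ ν).symm)

theorem measurePreserving_swapEntry {n : ℕ} (i : Fin n) :
    MeasurePreserving (swapEntry (E := E) i)
      (μ.prod (Measure.pi fun _ : Fin n => μ)) (μ.prod (Measure.pi fun _ : Fin n => μ)) := by
  cases n with
  | zero => exact i.elim0
  | succ m =>
    have he := measurePreserving_piFinSuccAbove (fun _ : Fin (m + 1) => μ) i
    have h := ((MeasurePreserving.id μ).prod he.symm).comp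
      ((measurePreserving_swapFirstTwo μ (Measure.pi fun _ : Fin m => μ)).comp
        ((MeasurePreserving.id μ).prod he))
    convert h using 1
    ext q : 1
    refine Prod.ext rfl ?_
    exact (Fin.insertNth_removeNth i q.1 q.2).symm

end Swap

/-! ### The second-moment bound for leave-one-out averages -/

theorem abs_integral_mul_sub_integral_mul_le {α : Type*} [MeasurableSpace α] {μ : Measure α}
    [IsFiniteMeasure μ] {a b a' b' : α → ℝ} {B : ℝ}
    (ha : Measurable a) (hb : Measurable b) (ha' : Measurable a') (hb' : Measurable b')
    (hA : ∀ x, |a x| ≤ B) (hB : ∀ x, |b x| ≤ B) (hA' : ∀ x, |a' x| ≤ B) (hB' : ∀ x, |b' x| ≤ B) :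
    |∫ x, a x * b x ∂μ - ∫ x, a' x * b' x ∂μ|
      ≤ B * (∫ x, |a x - a' x| ∂μ + ∫ x, |b x - b' x| ∂μ) := by
  have hmul : ∀ {u v : α → ℝ}, Measurable u → Measurable v → (∀ x, |u x| ≤ B) →
      (∀ x, |v x| ≤ B) → Integrable (fun x => u x * v x) μ := fun hu hv hU hV =>
    integrable_of_abs_le (C := B * B) (hu.mul hv) fun x => by
      rw [abs_mul]
      exact mul_le_mul (hU x) (hV x) (abs_nonneg _) ((abs_nonneg _).trans (hU x))
  have hdiff : ∀ {u v : α → ℝ}, Measurable u → Measurable v → (∀ x, |u x| ≤ B) →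
      (∀ x, |v x| ≤ B) → Integrable (fun x => |u x - v x|) μ := fun hu hv hU hV =>
    ((integrable_of_abs_le hu hU).sub (integrable_of_abs_le hv hV)).abs
  rw [← integral_sub (hmul ha hb hA hB) (hmul ha' hb' hA' hB'),
    ← integral_add (hdiff ha ha' hA hA') (hdiff hb hb' hB hB'), ← integral_const_mul]
  refine abs_integral_le_integral_abs.trans (integral_mono
    ((hmul ha hb hA hB).sub (hmul ha' hb' hA' hB')).abs
    (((hdiff ha ha' hA hA').add (hdiff hb hb' hB hB')).const_mul B) fun x => ?_)
  have : a x * b x - a' x * b' x = (a x - a' x) * b x + a' x * (b x - b' x) := by ring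
  simp only [this, mul_add]
  refine (abs_add_le _ _).trans ?_
  rw [abs_mul, abs_mul, mul_comm |a x - a' x|]
  gcongr
  exacts [hB x, hA' x]

section LeaveOneOut

variable {E : Type*} [MeasurableSpace E] {n : ℕ}

/-- A family `H` of functions of a point and a sample, bounded by `B` together with `G`, such that
`H i` ignores the `i`-th entry of the sample. -/
structure IsLeaveOneOutFamily (G : E × (Fin n → E) → ℝ) (H : Fin n → E × (Fin n → E) → ℝ)
    (B : ℝ) : Prop where
  measurable_full : Measurable G
  measurable_loo : ∀ i, Measurable (H i)
  abs_full_le : ∀ q, |G q| ≤ B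
  abs_loo_le : ∀ i q, |H i q| ≤ B
  loo_update : ∀ i z T w, H i (z, Function.update T i w) = H i (z, T)

variable {G : E × (Fin n → E) → ℝ} {H : Fin n → E × (Fin n → E) → ℝ} {B : ℝ}

theorem IsLeaveOneOutFamily.bound_nonneg (h : IsLeaveOneOutFamily G H B)
    (μ : Measure E) [IsProbabilityMeasure μ] : 0 ≤ B := by
  have : Nonempty E := μ.nonempty_of_neZero
  exact (abs_nonneg _).trans (h.abs_full_le (Classical.arbitrary _))

/-- The expected effect of removing the `i`-th sample point, evaluated at a fresh point. -/
noncomputable def removalEffect (μ : Measure E) (G : E × (Fin n → E) → ℝ)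
    (H : Fin n → E × (Fin n → E) → ℝ) (i : Fin n) : ℝ :=
  ∫ q, |G q - H i q| ∂(μ.prod (Measure.pi fun _ : Fin n => μ))

theorem removalEffect_nonneg (μ : Measure E) (i : Fin n) : 0 ≤ removalEffect μ G H i :=
  integral_nonneg fun _ => abs_nonneg _

variable {μ : Measure E}

/-- The removal effect may be computed along any random pair with the law of a fresh point and
a sample. -/
theorem IsLeaveOneOutFamily.integral_abs_comp {α : Type*} [MeasurableSpace α] {Q : Measure α}
    (h : IsLeaveOneOutFamily G H B) {φ : α → E × (Fin n → E)}
    (hφ : MeasurePreserving φ Q (μ.prod (Measure.pi fun _ : Fin n => μ))) (i : Fin n) :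
    ∫ q, |G (φ q) - H i (φ q)| ∂Q = removalEffect μ G H i := by
  rw [removalEffect, ← hφ.map_eq, integral_map hφ.measurable.aemeasurable]
  exact ((h.measurable_full.sub (h.measurable_loo i)).abs).aestronglyMeasurable

theorem IsLeaveOneOutFamily.integral_abs_comp' {α : Type*} [MeasurableSpace α] {Q : Measure α}
    (h : IsLeaveOneOutFamily G H B) {φ : α → E × (Fin n → E)}
    (hφ : MeasurePreserving φ Q (μ.prod (Measure.pi fun _ : Fin n => μ))) (i : Fin n) :
    ∫ q, |H i (φ q) - G (φ q)| ∂Q = removalEffect μ G H i := by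
  simp_rw [abs_sub_comm (H i _)]
  exact h.integral_abs_comp hφ i

/-- The law of two fresh points and a sample. -/
noncomputable abbrev twoFreshLaw (μ : Measure E) (n : ℕ) : Measure (E × (E × (Fin n → E))) :=
  μ.prod (μ.prod (Measure.pi fun _ : Fin n => μ))

/-- Exchange the second fresh point with the `i`-th sample point. -/
def swapSecondFresh (i : Fin n) (q : E × (E × (Fin n → E))) : E × (E × (Fin n → E)) :=
  (q.1, swapEntry i q.2)

/-- Exchange the first fresh point with the `i`-th sample point. -/
def swapFirstFresh (i : Fin n) (q : E × (E × (Fin n → E))) : E × (E × (Fin n → E)) :=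
  (q.2.2 i, (q.2.1, Function.update q.2.2 i q.1))

section

variable (μ) [IsProbabilityMeasure μ]

theorem measurePreserving_swapSecondFresh (i : Fin n) :
    MeasurePreserving (swapSecondFresh (E := E) i) (twoFreshLaw μ n) (twoFreshLaw μ n) :=
  (MeasurePreserving.id μ).prod (measurePreserving_swapEntry μ i)

theorem measurePreserving_swapFirstFresh (i : Fin n) :
    MeasurePreserving (swapFirstFresh (E := E) i) (twoFreshLaw μ n) (twoFreshLaw μ n) :=
  (measurePreserving_swapFirstTwo μ _).comp
    ((measurePreserving_swapSecondFresh μ i).comp (measurePreserving_swapFirstTwo μ _))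

theorem measurePreserving_secondFresh :
    MeasurePreserving (fun q : E × (E × (Fin n → E)) => q.2) (twoFreshLaw μ n)
      (μ.prod (Measure.pi fun _ : Fin n => μ)) :=
  measurePreserving_snd

theorem measurePreserving_firstFresh :
    MeasurePreserving (fun q : E × (E × (Fin n → E)) => (q.1, q.2.2)) (twoFreshLaw μ n)
      (μ.prod (Measure.pi fun _ : Fin n => μ)) :=
  (measurePreserving_secondFresh μ).comp (measurePreserving_swapFirstTwo μ _)

end

/-- The second moment of the conditional risk, written with two fresh points. -/
noncomputable def riskSecondMoment (μ : Measure E) (G : E × (Fin n → E) → ℝ) : ℝ :=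
  ∫ q, G (q.1, q.2.2) * G q.2 ∂(twoFreshLaw μ n)

theorem IsLeaveOneOutFamily.integral_comp_eq_riskSecondMoment (h : IsLeaveOneOutFamily G H B)
    {φ : E × (E × (Fin n → E)) → E × (E × (Fin n → E))}
    (hφ : MeasurePreserving φ (twoFreshLaw μ n) (twoFreshLaw μ n)) :
    ∫ q, G ((φ q).1, (φ q).2.2) * G (φ q).2 ∂(twoFreshLaw μ n) = riskSecondMoment μ G := by
  have hG := h.measurable_full
  rw [riskSecondMoment]
  conv_rhs => rw [← hφ.map_eq]
  rw [integral_map hφ.measurable.aemeasurable]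
  exact ((hG.comp (by fun_prop)).mul (hG.comp (by fun_prop))).aestronglyMeasurable

theorem IsLeaveOneOutFamily.loo_update_eq (h : IsLeaveOneOutFamily G H B) {i : Fin n} {z : E}
    {T T' : Fin n → E} {w : E} (hT : T' = Function.update T i w) : H i (z, T) = H i (z, T') := by
  rw [hT, h.loo_update]

theorem IsLeaveOneOutFamily.integrable_comp_sub {α : Type*} [MeasurableSpace α] {Q : Measure α}
    [IsFiniteMeasure Q] (h : IsLeaveOneOutFamily G H B) {φ : α → E × (Fin n → E)}
    (hφ : Measurable φ) (i : Fin n) : Integrable (fun q => |G (φ q) - H i (φ q)|) Q :=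
  ((integrable_of_abs_le (h.measurable_full.comp hφ) fun _ => h.abs_full_le _).sub
    (integrable_of_abs_le ((h.measurable_loo i).comp hφ) fun _ => h.abs_loo_le i _)).abs

variable [IsProbabilityMeasure μ]

/-- Mixed moments of the risk and a leave-one-out term: replacing the `i`-th sample point by a
second fresh point turns the leave-one-out term into a copy of the risk. -/
theorem IsLeaveOneOutFamily.abs_cross_sub_le (h : IsLeaveOneOutFamily G H B) (i : Fin n) :
    |∫ q, G (q.1, q.2.2) * H i (q.2.2 i, q.2.2) ∂(twoFreshLaw μ n) - riskSecondMoment μ G|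
      ≤ B * (3 * removalEffect μ G H i) := by
  have hs := measurePreserving_swapSecondFresh μ i
  have hG := h.measurable_full
  have hH := h.measurable_loo i
  have hA := measurePreserving_firstFresh (n := n) μ
  have hC := measurePreserving_secondFresh (n := n) μ
  rw [← h.integral_comp_eq_riskSecondMoment hs]
  have hm : Measurable fun q : E × (E × (Fin n → E)) => H i (q.2.2 i, q.2.2) :=
    hH.comp (by fun_prop)
  refine (abs_integral_mul_sub_integral_mul_le (hG.comp hA.measurable) hm
    (hG.comp (hA.comp hs).measurable) (hG.comp (hC.comp hs).measurable)
    (fun _ => h.abs_full_le _) (fun _ => h.abs_loo_le _ _) (fun _ => h.abs_full_le _)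
    (fun _ => h.abs_full_le _)).trans ?_
  have hB : 0 ≤ B := h.bound_nonneg μ
  gcongr
  have h1 : ∫ q, |G (q.1, q.2.2) - G ((swapSecondFresh i q).1, (swapSecondFresh i q).2.2)|
      ∂(twoFreshLaw μ n) ≤ 2 * removalEffect μ G H i := by
    rw [two_mul]
    nth_rw 1 [← h.integral_abs_comp hA i]
    rw [← h.integral_abs_comp (hA.comp hs) i, ← integral_add (h.integrable_comp_sub hA.measurable i)
      (h.integrable_comp_sub (hA.comp hs).measurable i)]
    refine integral_mono
      ((integrable_of_abs_le (hG.comp hA.measurable) fun _ => h.abs_full_le _).sub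
        (integrable_of_abs_le (hG.comp (hA.comp hs).measurable) fun _ => h.abs_full_le _)).abs
      ((h.integrable_comp_sub hA.measurable i).add
      (h.integrable_comp_sub (hA.comp hs).measurable i)) fun q => ?_
    have e : H i (q.1, q.2.2) = H i ((swapSecondFresh i q).1, (swapSecondFresh i q).2.2) :=
      h.loo_update_eq rfl
    simp only [Function.comp_apply]
    rw [abs_sub_comm (G ((swapSecondFresh i q).1, _)), e]
    exact abs_sub_le _ _ _
  have h2 : ∫ q, |H i (q.2.2 i, q.2.2) - G (swapSecondFresh i q).2| ∂(twoFreshLaw μ n)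
      = removalEffect μ G H i := by
    rw [← h.integral_abs_comp' (hC.comp hs) i]
    congr 1 with q
    simp only [Function.comp_apply]
    rw [show H i (q.2.2 i, q.2.2) = H i (swapSecondFresh i q).2 from h.loo_update_eq rfl]
  simp only [Function.comp_apply]
  linarith

theorem abs_sub_le_three {a b c d x y z : ℝ} (hab : |a - b| ≤ x) (hbc : |b - c| ≤ y)
    (hcd : |c - d| ≤ z) : |a - d| ≤ x + y + z := by
  have h1 := abs_sub_le a b c
  have h2 := abs_sub_le a c d
  linarith

/-- Mixed moments of two leave-one-out terms: replacing both left-out points by fresh points turns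
the two terms into copies of the risk. -/
theorem IsLeaveOneOutFamily.abs_pair_sub_le (h : IsLeaveOneOutFamily G H B) {i j : Fin n}
    (hij : i ≠ j) :
    |∫ q, H i (q.2.2 i, q.2.2) * H j (q.2.2 j, q.2.2) ∂(twoFreshLaw μ n) - riskSecondMoment μ G|
      ≤ B * (3 * (removalEffect μ G H i + removalEffect μ G H j)) := by
  have hK := measurePreserving_swapSecondFresh μ j
  have hW := measurePreserving_swapFirstFresh μ i
  have hWK := hW.comp hK
  have hG := h.measurable_full
  have hA := measurePreserving_firstFresh (n := n) μ
  have hC := measurePreserving_secondFresh (n := n) μ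
  rw [← h.integral_comp_eq_riskSecondMoment hWK]
  have hm : ∀ k, Measurable fun q : E × (E × (Fin n → E)) => H k (q.2.2 k, q.2.2) := fun k =>
    (h.measurable_loo k).comp (by fun_prop)
  refine (abs_integral_mul_sub_integral_mul_le (hm i) (hm j)
    (hG.comp (hA.comp hWK).measurable) (hG.comp (hC.comp hWK).measurable)
    (fun _ => h.abs_loo_le _ _) (fun _ => h.abs_loo_le _ _) (fun _ => h.abs_full_le _)
    (fun _ => h.abs_full_le _)).trans ?_
  have hB : 0 ≤ B := h.bound_nonneg μ
  gcongr
  -- Both estimates replace one left-out point at a time.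
  have step : ∀ (k l : Fin n) {φ ψ : E × (E × (Fin n → E)) → E × (Fin n → E)},
      MeasurePreserving φ (twoFreshLaw μ n) (μ.prod (Measure.pi fun _ : Fin n => μ)) →
      MeasurePreserving ψ (twoFreshLaw μ n) (μ.prod (Measure.pi fun _ : Fin n => μ)) →
      (∀ q, H k (q.2.2 k, q.2.2) = H k (φ q)) → (∀ q, H l (φ q) = H l (ψ q)) →
      ∫ q, |H k (q.2.2 k, q.2.2) - G (ψ q)| ∂(twoFreshLaw μ n)
        ≤ removalEffect μ G H k + 2 * removalEffect μ G H l := by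
    intro k l φ ψ hφ hψ e1 e2
    have i1 := h.integrable_comp_sub (Q := twoFreshLaw μ n) hφ.measurable k
    have i2 := h.integrable_comp_sub (Q := twoFreshLaw μ n) hφ.measurable l
    have i3 := h.integrable_comp_sub (Q := twoFreshLaw μ n) hψ.measurable l
    rw [two_mul, ← add_assoc, ← h.integral_abs_comp hφ k]
    nth_rw 1 [← h.integral_abs_comp hφ l]
    rw [← h.integral_abs_comp hψ l, ← integral_add i1 i2,
      ← integral_add (by exact i1.add i2) i3]
    refine integral_mono ((integrable_of_abs_le (hm k) fun _ => h.abs_loo_le _ _).sub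
        (integrable_of_abs_le (hG.comp hψ.measurable) fun _ => h.abs_full_le _)).abs
      ((i1.add i2).add i3) fun q => ?_
    simp only
    refine abs_sub_le_three (b := G (φ q)) (c := H l (φ q)) ?_ le_rfl ?_
    · rw [e1, abs_sub_comm]
    · rw [e2, abs_sub_comm]
  have h1 := step i j (hA.comp hW) (hA.comp hWK)
    (fun q => h.loo_update_eq rfl) (fun q => by
      simp only [Function.comp_apply, swapFirstFresh, swapSecondFresh, swapEntry,
        Function.update_of_ne hij]
      exact h.loo_update_eq (Function.update_comm hij.symm _ _ _))
  have h2 := step j i (hC.comp hK) (hC.comp hWK)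
    (fun q => h.loo_update_eq rfl) (fun q => h.loo_update_eq rfl)
  simp only [Function.comp_apply] at h1 h2 ⊢
  linarith

end LeaveOneOut

section Risk

variable {E : Type*} [MeasurableSpace E] {n : ℕ} {G : E × (Fin n → E) → ℝ}
  {H : Fin n → E × (Fin n → E) → ℝ} {B : ℝ}

/-- The conditional risk given the sample: the average of `G` over a fresh point. -/
noncomputable def sampleRisk (μ : Measure E) (G : E × (Fin n → E) → ℝ) (T : Fin n → E) : ℝ :=
  ∫ z, G (z, T) ∂μ

/-- The leave-one-out estimator of the conditional risk. -/
noncomputable def looRisk (H : Fin n → E × (Fin n → E) → ℝ) (T : Fin n → E) : ℝ :=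
  (1 / (n : ℝ)) * ∑ i, H i (T i, T)

theorem integral_comp_measurePreserving {α β : Type*} [MeasurableSpace α] [MeasurableSpace β]
    {P : Measure α} {Q : Measure β} {φ : α → β} (hφ : MeasurePreserving φ P Q) {f : β → ℝ}
    (hf : Measurable f) : ∫ x, f (φ x) ∂P = ∫ y, f y ∂Q := by
  rw [← hφ.map_eq, integral_map hφ.measurable.aemeasurable hf.aestronglyMeasurable]

theorem abs_integral_le_of_abs_le {α : Type*} [MeasurableSpace α] {P : Measure α}
    [IsProbabilityMeasure P] {f : α → ℝ} {C : ℝ} (hf : ∀ x, |f x| ≤ C) : |∫ x, f x ∂P| ≤ C := by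
  simpa using norm_integral_le_of_norm_le_const (μ := P) (f := f) (C := C) (Eventually.of_forall hf)

variable {μ : Measure E} [IsProbabilityMeasure μ]

theorem measurable_sampleRisk (hG : Measurable G) : Measurable (sampleRisk μ G) :=
  (hG.stronglyMeasurable.integral_prod_left' (μ := μ)).measurable

theorem abs_sampleRisk_le (hG : ∀ q, |G q| ≤ B) (T : Fin n → E) : |sampleRisk μ G T| ≤ B :=
  abs_integral_le_of_abs_le fun z => hG (z, T)

theorem IsLeaveOneOutFamily.measurable_apply_self (h : IsLeaveOneOutFamily G H B) (i : Fin n) :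
    Measurable fun T : Fin n → E => H i (T i, T) :=
  (h.measurable_loo i).comp (by fun_prop)

theorem IsLeaveOneOutFamily.measurable_looRisk (h : IsLeaveOneOutFamily G H B) :
    Measurable (looRisk H) :=
  (Finset.measurable_sum _ fun i _ => h.measurable_apply_self i).const_mul _

theorem abs_mul_le_of_abs_le {a b B : ℝ} (ha : |a| ≤ B) (hb : |b| ≤ B) : |a * b| ≤ B * B := by
  rw [abs_mul]
  exact mul_le_mul ha hb (abs_nonneg _) ((abs_nonneg _).trans ha)

/-- Integrating out the first fresh point replaces `G` by the conditional risk. -/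
theorem integral_twoFreshLaw_mul (hG : Measurable G) (hGB : ∀ q, |G q| ≤ B)
    {W : E × (Fin n → E) → ℝ} (hW : Measurable W) (hWB : ∀ q, |W q| ≤ B) :
    ∫ q, G (q.1, q.2.2) * W q.2 ∂(twoFreshLaw μ n)
      = ∫ r, sampleRisk μ G r.2 * W r ∂(μ.prod (Measure.pi fun _ : Fin n => μ)) := by
  rw [twoFreshLaw, integral_prod_symm]
  · simp_rw [integral_mul_const]
    rfl
  · exact integrable_of_abs_le (C := B * B) ((hG.comp (by fun_prop)).mul (hW.comp (by fun_prop)))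
      fun q => abs_mul_le_of_abs_le (hGB _) (hWB _)

theorem integral_sampleRisk_sq (hG : Measurable G) (hGB : ∀ q, |G q| ≤ B) :
    ∫ T, sampleRisk μ G T * sampleRisk μ G T ∂(Measure.pi fun _ : Fin n => μ)
      = riskSecondMoment μ G := by
  rw [riskSecondMoment, integral_twoFreshLaw_mul hG hGB hG hGB, integral_prod_symm]
  · simp_rw [integral_const_mul]
    rfl
  · exact integrable_of_abs_le (C := B * B)
      (((measurable_sampleRisk hG).comp measurable_snd).mul hG)
      fun q => abs_mul_le_of_abs_le (abs_sampleRisk_le hGB _) (hGB _)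

theorem integral_sampleRisk_mul (hG : Measurable G) (hGB : ∀ q, |G q| ≤ B)
    {V : (Fin n → E) → ℝ} (hV : Measurable V) (hVB : ∀ T, |V T| ≤ B) :
    ∫ T, sampleRisk μ G T * V T ∂(Measure.pi fun _ : Fin n => μ)
      = ∫ q, G (q.1, q.2.2) * V q.2.2 ∂(twoFreshLaw μ n) := by
  rw [integral_twoFreshLaw_mul (W := fun r => V r.2) hG hGB (hV.comp measurable_snd)
    fun _ => hVB _]
  exact (integral_comp_measurePreserving (f := fun T => sampleRisk μ G T * V T)
    (measurePreserving_snd (μ := μ)) ((measurable_sampleRisk hG).mul hV)).symm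

/-- Covariances of the centred leave-one-out terms. -/
theorem IsLeaveOneOutFamily.integral_mul_le (h : IsLeaveOneOutFamily G H B) (i j : Fin n) :
    ∫ T, (sampleRisk μ G T - H i (T i, T)) * (sampleRisk μ G T - H j (T j, T))
        ∂(Measure.pi fun _ : Fin n => μ)
      ≤ 6 * B * (removalEffect μ G H i + removalEffect μ G H j)
        + if i = j then 4 * B ^ 2 else 0 := by
  have hB := h.bound_nonneg μ
  have hG := h.measurable_full
  have hR : Measurable (sampleRisk μ G) := measurable_sampleRisk hG
  have hRB : ∀ T, |sampleRisk μ G T| ≤ B := abs_sampleRisk_le h.abs_full_le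
  have hS := h.measurable_apply_self
  have d0 := removalEffect_nonneg (G := G) (H := H) μ
  split_ifs with hij
  · subst hij
    have hle : ∀ T, |sampleRisk μ G T - H i (T i, T)| ≤ 2 * B := fun T => by
      refine (abs_sub _ _).trans ?_
      linarith [hRB T, h.abs_loo_le i (T i, T)]
    have : ∫ T, (sampleRisk μ G T - H i (T i, T)) * (sampleRisk μ G T - H i (T i, T))
        ∂(Measure.pi fun _ : Fin n => μ) ≤ 4 * B ^ 2 := by
      refine (le_abs_self _).trans (abs_integral_le_of_abs_le fun T => ?_)
      refine (abs_mul_le_of_abs_le (hle T) (hle T)).trans_eq (by ring)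
    have : 0 ≤ 6 * B * (removalEffect μ G H i + removalEffect μ G H i) :=
      mul_nonneg (by positivity) (add_nonneg (d0 i) (d0 i))
    linarith
  · have hmul : ∀ {u v : (Fin n → E) → ℝ}, Measurable u → Measurable v → (∀ T, |u T| ≤ B) →
        (∀ T, |v T| ≤ B) → Integrable (fun T => u T * v T) (Measure.pi fun _ : Fin n => μ) :=
      fun hu hv hU hV => integrable_of_abs_le (C := B * B) (hu.mul hv)
        fun T => abs_mul_le_of_abs_le (hU T) (hV T)
    have hSB : ∀ i, ∀ T : Fin n → E, |H i (T i, T)| ≤ B := fun i T => h.abs_loo_le _ _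
    have i1 := hmul hR hR hRB hRB
    have i2 := hmul hR (hS i) hRB (hSB i)
    have i3 := hmul hR (hS j) hRB (hSB j)
    have i4 := hmul (hS i) (hS j) (hSB i) (hSB j)
    have e : ∀ T : Fin n → E,
        (sampleRisk μ G T - H i (T i, T)) * (sampleRisk μ G T - H j (T j, T))
          = sampleRisk μ G T * sampleRisk μ G T - sampleRisk μ G T * H i (T i, T)
            - sampleRisk μ G T * H j (T j, T) + H i (T i, T) * H j (T j, T) := fun T => by ring
    simp_rw [e]
    rw [integral_add (by exact (i1.sub i2).sub i3) i4, integral_sub (by exact i1.sub i2) i3,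
      integral_sub i1 i2, integral_sampleRisk_sq hG h.abs_full_le,
      integral_sampleRisk_mul hG h.abs_full_le (hS i) (hSB i),
      integral_sampleRisk_mul hG h.abs_full_le (hS j) (hSB j),
      ← integral_comp_measurePreserving (f := fun T => H i (T i, T) * H j (T j, T))
        (measurePreserving_snd.comp (measurePreserving_secondFresh (n := n) μ))
        ((hS i).mul (hS j))]
    have c1 := abs_le.1 (h.abs_cross_sub_le (μ := μ) i)
    have c2 := abs_le.1 (h.abs_cross_sub_le (μ := μ) j)
    have c3 := abs_le.1 (h.abs_pair_sub_le (μ := μ) hij)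
    simp only [Function.comp_apply]
    linarith [c1.1, c2.1, c3.2]

theorem sq_integral_abs_le_integral_sq {α : Type*} [MeasurableSpace α] {P : Measure α}
    [IsProbabilityMeasure P] {X : α → ℝ} (hX : Integrable X P)
    (hX2 : Integrable (fun x => X x ^ 2) P) :
    (∫ x, |X x| ∂P) ^ 2 ≤ ∫ x, X x ^ 2 ∂P := by
  set c := ∫ x, |X x| ∂P with hc
  have h0 : 0 ≤ ∫ x, (X x ^ 2 - 2 * c * |X x| + c ^ 2) ∂P := integral_nonneg fun x => by
    have : X x ^ 2 - 2 * c * |X x| + c ^ 2 = (|X x| - c) ^ 2 := by rw [← sq_abs]; ring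
    simp only [this]
    positivity
  rw [integral_add (by exact hX2.sub (hX.abs.const_mul _)) (integrable_const _),
    integral_sub hX2 (hX.abs.const_mul _), integral_const_mul, ← hc] at h0
  simp only [integral_const, probReal_univ, one_smul] at h0
  nlinarith

/-- The leave-one-out estimator is close in mean to the conditional risk as soon as the sample is
large and removing one sample point has little effect on average. -/
theorem IsLeaveOneOutFamily.integral_abs_sampleRisk_sub_looRisk_le
    (h : IsLeaveOneOutFamily G H B) (hn : 0 < n) :
    ∫ T, |sampleRisk μ G T - looRisk H T| ∂(Measure.pi fun _ : Fin n => μ)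
      ≤ √(12 * B * ((1 / (n : ℝ)) * ∑ i, removalEffect μ G H i) + 4 * B ^ 2 / n) := by
  have hn' : (n : ℝ) ≠ 0 := by positivity
  have hR : Measurable (sampleRisk μ G) := measurable_sampleRisk h.measurable_full
  have hRB : ∀ T, |sampleRisk μ G T| ≤ B := abs_sampleRisk_le h.abs_full_le
  have hS := h.measurable_apply_self
  have hle : ∀ i T, |sampleRisk μ G T - H i (T i, T)| ≤ 2 * B := fun i T => by
    refine (abs_sub _ _).trans ?_
    linarith [hRB T, h.abs_loo_le i (T i, T)]
  have hD : ∀ T, sampleRisk μ G T - looRisk H T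
      = (1 / (n : ℝ)) * ∑ i, (sampleRisk μ G T - H i (T i, T)) := fun T => by
    rw [Finset.sum_sub_distrib, looRisk, mul_sub]
    simp [hn']
  have hsq : ∀ T, (sampleRisk μ G T - looRisk H T) ^ 2 = (1 / (n : ℝ)) ^ 2 *
      ∑ i, ∑ j, (sampleRisk μ G T - H i (T i, T)) * (sampleRisk μ G T - H j (T j, T)) :=
    fun T => by rw [hD, mul_pow, sq (∑ i, _), Finset.sum_mul_sum]
  have hij : ∀ i j, Integrable (fun T => (sampleRisk μ G T - H i (T i, T)) *
      (sampleRisk μ G T - H j (T j, T))) (Measure.pi fun _ : Fin n => μ) := fun i j =>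
    integrable_of_abs_le ((hR.sub (hS i)).mul (hR.sub (hS j)))
      fun T => abs_mul_le_of_abs_le (hle i T) (hle j T)
  refine Real.le_sqrt_of_sq_le ((sq_integral_abs_le_integral_sq ?_ ?_).trans ?_)
  · simp_rw [hD]
    exact (integrable_finsetSum _ fun i _ =>
      integrable_of_abs_le (hR.sub (hS i)) (hle i)).const_mul _
  · simp_rw [hsq]
    exact (integrable_finsetSum _ fun i _ => integrable_finsetSum _ fun j _ =>
      hij i j).const_mul _
  · simp_rw [hsq]
    rw [integral_const_mul, integral_finsetSum _ fun i _ => integrable_finsetSum _ fun j _ =>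
      hij i j]
    simp_rw [integral_finsetSum _ fun j _ => hij _ j]
    calc (1 / (n : ℝ)) ^ 2 * ∑ i, ∑ j, ∫ T, (sampleRisk μ G T - H i (T i, T)) *
          (sampleRisk μ G T - H j (T j, T)) ∂(Measure.pi fun _ : Fin n => μ)
        ≤ (1 / (n : ℝ)) ^ 2 * ∑ i, ∑ j, (6 * B * (removalEffect μ G H i + removalEffect μ G H j)
          + if i = j then 4 * B ^ 2 else 0) := by
          gcongr with i _ j _
          exact h.integral_mul_le i j
      _ = _ := by
          simp only [Finset.sum_add_distrib, ← Finset.mul_sum, Finset.sum_const, Finset.card_univ,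
            Fintype.card_fin, Finset.sum_ite_eq, Finset.mem_univ, if_true, nsmul_eq_mul]
          field_simp
          ring

end Risk

/-! ### Conditional expectations given the sample -/

/-- If `(X, Y)` has a product law then conditioning on `Y` integrates out `X`. -/
theorem condExp_comp_ae_eq_integral {Ω E F : Type*} {mΩ : MeasurableSpace Ω} [MeasurableSpace E]
    [mF : MeasurableSpace F] {P : Measure Ω} [IsProbabilityMeasure P] {μ : Measure E}
    [IsProbabilityMeasure μ] {ν : Measure F} [IsProbabilityMeasure ν] {J : Ω → E × F}
    (hJ : MeasurePreserving J P (μ.prod ν)) {f : E × F → ℝ} (hf : Measurable f)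
    (hfi : Integrable f (μ.prod ν)) :
    P[fun ω => f (J ω) | mF.comap fun ω => (J ω).2]
      =ᵐ[P] fun ω => ∫ z, f (z, (J ω).2) ∂μ := by
  have hY : Measurable fun ω => (J ω).2 := measurable_snd.comp hJ.measurable
  have hJY : MeasurePreserving (fun ω => (J ω).2) P ν :=
    measurePreserving_snd.comp hJ
  have hr : Measurable fun y => ∫ z, f (z, y) ∂μ :=
    (hf.stronglyMeasurable.integral_prod_left' (μ := μ)).measurable
  have hri : Integrable (fun y => ∫ z, f (z, y) ∂μ) ν := hfi.integral_prod_right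
  refine (ae_eq_condExp_of_forall_setIntegral_eq hY.comap_le ?_ ?_ ?_ ?_).symm
  · exact hJ.integrable_comp_of_integrable hfi
  · exact fun s _ _ => (hJY.integrable_comp_of_integrable hri).integrableOn
  · rintro s ⟨t, ht, rfl⟩ -
    have e1 : ∫ ω in (fun ω => (J ω).2) ⁻¹' t, (fun y => ∫ z, f (z, y) ∂μ) (J ω).2 ∂P
        = ∫ y in t, ∫ z, f (z, y) ∂μ ∂ν := by
      rw [← hJY.map_eq, setIntegral_map ht (hJY.map_eq ▸ hr.aestronglyMeasurable)
        hY.aemeasurable]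
    have e2 : ∫ ω in (fun ω => (J ω).2) ⁻¹' t, f (J ω) ∂P
        = ∫ q in Set.univ ×ˢ t, f q ∂(μ.prod ν) := by
      rw [← hJ.map_eq, setIntegral_map (MeasurableSet.univ.prod ht)
        hf.aestronglyMeasurable hJ.measurable.aemeasurable]
      congr 2
      ext ω
      simp
    rw [e1, e2, ← Measure.prod_restrict, Measure.restrict_univ, integral_prod_symm]
    rw [← Measure.restrict_univ (μ := μ), Measure.prod_restrict]
    exact hfi.integrableOn
  · exact (hr.comp (comap_measurable _)).stronglyMeasurable.aestronglyMeasurable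

/-! ### Residuals of a prediction algorithm -/

section Residuals

variable {p n : ℕ}

theorem dropObs_eq_removeNth {m : ℕ} (i : Fin (m + 1)) (T : Fin (m + 1) → Obs p) :
    dropObs (i : ℕ) T = i.removeNth T := by
  funext j
  simp only [dropObs, Fin.removeNth, Fin.succAbove, Fin.lt_def, Fin.val_castSucc]
  congr 1
  ext
  simp only
  split_ifs <;> rfl

theorem dropObs_update (i : Fin n) (T : Fin n → Obs p) (w : Obs p) :
    dropObs (i : ℕ) (Function.update T i w) = dropObs (i : ℕ) T := by
  cases n with
  | zero => exact i.elim0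
  | succ m => rw [dropObs_eq_removeNth, dropObs_eq_removeNth, Fin.removeNth_update]

theorem measurePreserving_dropObs (μ : Measure (Obs p)) [IsProbabilityMeasure μ] (i : Fin n) :
    MeasurePreserving (dropObs (p := p) (n := n) (i : ℕ)) (Measure.pi fun _ : Fin n => μ)
      (Measure.pi fun _ : Fin (n - 1) => μ) := by
  cases n with
  | zero => exact i.elim0
  | succ m =>
    have h := (measurePreserving_snd (μ := μ) (ν := Measure.pi fun _ : Fin m => μ)).comp
      (measurePreserving_piFinSuccAbove (fun _ : Fin (m + 1) => μ) i)
    have e : (Prod.snd ∘ MeasurableEquiv.piFinSuccAbove (fun _ : Fin (m + 1) => Obs p) i)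
        = dropObs (p := p) (n := m + 1) (i : ℕ) :=
      funext fun T => (dropObs_eq_removeNth i T).symm
    rw [← e]
    exact h

/-- The prediction error at a point, for the predictor trained on a sample. -/
def predError (𝒜 : PredAlg) (q : Obs p × (Fin n → Obs p)) : ℝ := q.1.1 - 𝒜 p n q.1.2 q.2

theorem measurable_predError {𝒜 : PredAlg} (h𝒜 : 𝒜.IsMeasurable) :
    Measurable (predError (p := p) (n := n) 𝒜) :=
  measurable_fst.fst.sub ((h𝒜 p n).comp (measurable_fst.snd.prodMk measurable_snd))

/-- Remove the `i`-th entry from the sample of a pair of a point and a sample. -/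
def dropPair (i : Fin n) (q : Obs p × (Fin n → Obs p)) : Obs p × (Fin (n - 1) → Obs p) :=
  (q.1, dropObs i q.2)

theorem measurePreserving_dropPair (μ : Measure (Obs p)) [IsProbabilityMeasure μ] (i : Fin n) :
    MeasurePreserving (dropPair i) (μ.prod (Measure.pi fun _ : Fin n => μ))
      (μ.prod (Measure.pi fun _ : Fin (n - 1) => μ)) :=
  (MeasurePreserving.id μ).prod (measurePreserving_dropObs μ i)

theorem measurable_dropPair (i : Fin n) : Measurable (dropPair (p := p) i) := by
  refine measurable_fst.prodMk (measurable_pi_iff.2 fun j => ?_)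
  simp only [dropObs]
  fun_prop

theorem isLeaveOneOutFamily_predError {𝒜 : PredAlg} (h𝒜 : 𝒜.IsMeasurable) {g : ℝ → ℝ}
    (hg : Measurable g) {B : ℝ} (hB : ∀ t, |g t| ≤ B) :
    IsLeaveOneOutFamily (E := Obs p) (n := n) (fun q => g (predError 𝒜 q))
      (fun i q => g (predError 𝒜 (dropPair i q))) B where
  measurable_full := hg.comp (measurable_predError h𝒜)
  measurable_loo i := hg.comp ((measurable_predError h𝒜).comp (measurable_dropPair i))
  abs_full_le _ := hB _
  abs_loo_le _ _ := hB _
  loo_update i z T w := by simp only [dropPair, dropObs_update]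

/-- The new observation together with the training data. -/
def freshAndTraining {Ω : Type*} (Z : Fin (n + 1) → Ω → Obs p) (ω : Ω) : Obs p × (Fin n → Obs p) :=
  (Z (Fin.last n) ω, trainingData Z ω)

/-- The `i`-th residual is the prediction error at the `i`-th sample point. Putting the new
observation into the vacant `i`-th place is harmless, since that entry is dropped. -/
theorem looResidual_eq {Ω : Type*} (𝒜 : PredAlg) (Z : Fin (n + 1) → Ω → Obs p) (i : Fin n)
    (ω : Ω) :
    looResidual 𝒜 Z i ω = predError 𝒜 (dropPair i (swapEntry i (freshAndTraining Z ω))) := by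
  simp only [looResidual, predError, dropPair, swapEntry, freshAndTraining, dropObs_update]

end Residuals

section Sample

variable {Ω : Type*} [MeasurableSpace Ω] {p n : ℕ} {Z : Fin (n + 1) → Ω → Obs p}
  {μ : Measure (Obs p)} {P : Measure Ω}

theorem IsIIDSample.isProbabilityMeasure_law [IsProbabilityMeasure P] (hZ : IsIIDSample Z μ P) :
    IsProbabilityMeasure μ := by
  rw [← hZ.map_eq 0]
  exact Measure.isProbabilityMeasure_map (hZ.measurable 0).aemeasurable

theorem IsIIDSample.measurePreserving_freshAndTraining [IsProbabilityMeasure P]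
    (hZ : IsIIDSample Z μ P) :
    MeasurePreserving (freshAndTraining Z) P (μ.prod (Measure.pi fun _ : Fin n => μ)) := by
  have := hZ.isProbabilityMeasure_law
  have hpi : MeasurePreserving (fun ω i => Z i ω) P (Measure.pi fun _ : Fin (n + 1) => μ) :=
    ⟨measurable_pi_iff.2 hZ.measurable, by
      rw [(iIndepFun_iff_map_fun_eq_pi_map fun i => (hZ.measurable i).aemeasurable).1 hZ.indep]
      simp_rw [hZ.map_eq]⟩
  have h := (measurePreserving_piFinSuccAbove (fun _ : Fin (n + 1) => μ) (Fin.last n)).comp hpi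
  convert h using 1
  funext ω
  refine Prod.ext rfl ?_
  funext j
  change Z j.castSucc ω = Z ((Fin.last n).succAbove j) ω
  rw [Fin.succAbove_last]

variable [IsProbabilityMeasure P]

theorem IsIIDSample.measurable_freshError (hZ : IsIIDSample Z μ P) {𝒜 : PredAlg}
    (h𝒜 : 𝒜.IsMeasurable) : Measurable fun ω => newResponse Z ω - fullPred 𝒜 Z ω :=
  (measurable_predError h𝒜).comp hZ.measurePreserving_freshAndTraining.measurable

theorem IsIIDSample.measurable_looFreshError (hZ : IsIIDSample Z μ P) {𝒜 : PredAlg}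
    (h𝒜 : 𝒜.IsMeasurable) (i : Fin n) :
    Measurable fun ω => newResponse Z ω - looPred 𝒜 Z i ω :=
  (measurable_predError h𝒜).comp
    ((measurable_dropPair i).comp hZ.measurePreserving_freshAndTraining.measurable)

theorem IsIIDSample.measurable_looResidual (hZ : IsIIDSample Z μ P) {𝒜 : PredAlg}
    (h𝒜 : 𝒜.IsMeasurable) (i : Fin n) : Measurable (looResidual 𝒜 Z i) := by
  have := hZ.isProbabilityMeasure_law
  have h := (measurable_predError (p := p) h𝒜).comp ((measurable_dropPair i).comp
    ((measurePreserving_swapEntry μ i).measurable.comp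
      hZ.measurePreserving_freshAndTraining.measurable))
  convert h using 1
  funext ω
  exact looResidual_eq 𝒜 Z i ω

/-- All leave-one-out residuals, and all leave-one-out prediction errors at the fresh point, have
the law of the prediction error based on `n - 1` training points. -/
theorem IsIIDSample.lintegral_looResidual (hZ : IsIIDSample Z μ P) {𝒜 : PredAlg}
    (h𝒜 : 𝒜.IsMeasurable) {F : ℝ → ENNReal} (hF : Measurable F) (i j : Fin n) :
    ∫⁻ ω, F (looResidual 𝒜 Z i ω) ∂P = ∫⁻ ω, F (newResponse Z ω - looPred 𝒜 Z j ω) ∂P := by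
  have := hZ.isProbabilityMeasure_law
  have hJ := hZ.measurePreserving_freshAndTraining
  have hm : Measurable fun q => F (predError (p := p) (n := n - 1) 𝒜 q) :=
    hF.comp (measurable_predError h𝒜)
  have h1 := (((measurePreserving_dropPair μ i).comp (measurePreserving_swapEntry μ i)).comp
    hJ).lintegral_comp hm
  have h2 := ((measurePreserving_dropPair μ j).comp hJ).lintegral_comp hm
  simp_rw [looResidual_eq]
  exact h1.trans h2.symm

/-- Finite-sample bound for the error of the leave-one-out estimator of a bounded risk. -/
theorem IsIIDSample.lintegral_condExp_sub_le (hZ : IsIIDSample Z μ P) {𝒜 : PredAlg}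
    (h𝒜 : 𝒜.IsMeasurable) (hn : 0 < n) {g : ℝ → ℝ} (hg : Measurable g) {B : ℝ}
    (hB : ∀ t, |g t| ≤ B) :
    ∫⁻ ω, ‖(P[fun ω' => g (newResponse Z ω' - fullPred 𝒜 Z ω') | trainingSigma Z]) ω
        - (1 / (n : ℝ)) * ∑ i : Fin n, g (looResidual 𝒜 Z i ω)‖ₑ ∂P
      ≤ ENNReal.ofReal √(12 * B * ((1 / (n : ℝ)) * ∑ i : Fin n,
          ∫ ω, |g (newResponse Z ω - fullPred 𝒜 Z ω) - g (newResponse Z ω - looPred 𝒜 Z i ω)| ∂P)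
          + 4 * B ^ 2 / n) := by
  have := hZ.isProbabilityMeasure_law
  have hJ := hZ.measurePreserving_freshAndTraining
  have hfam := isLeaveOneOutFamily_predError (p := p) (n := n) h𝒜 hg hB
  have hJT : MeasurePreserving (trainingData Z) P (Measure.pi fun _ : Fin n => μ) :=
    measurePreserving_snd.comp hJ
  have hce := condExp_comp_ae_eq_integral hJ hfam.measurable_full
    (integrable_of_abs_le hfam.measurable_full hfam.abs_full_le)
  have hmeas := (measurable_sampleRisk (μ := μ) hfam.measurable_full).sub hfam.measurable_looRisk
  have e1 : ∫⁻ ω, ‖(P[fun ω' => g (newResponse Z ω' - fullPred 𝒜 Z ω') | trainingSigma Z]) ω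
        - (1 / (n : ℝ)) * ∑ i : Fin n, g (looResidual 𝒜 Z i ω)‖ₑ ∂P
      = ∫⁻ T, ‖sampleRisk μ (fun q => g (predError 𝒜 q)) T
        - looRisk (fun i q => g (predError 𝒜 (dropPair i q))) T‖ₑ
          ∂(Measure.pi fun _ : Fin n => μ) := by
    refine (lintegral_congr_ae ?_).trans (hJT.lintegral_comp hmeas.enorm)
    filter_upwards [hce] with ω hω
    exact congrArg (fun t : ℝ => ‖t - (1 / (n : ℝ)) * ∑ i : Fin n, g (looResidual 𝒜 Z i ω)‖ₑ) hω
  have hint : Integrable (fun T => sampleRisk μ (fun q => g (predError 𝒜 q)) T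
        - looRisk (fun i q => g (predError 𝒜 (dropPair i q))) T)
        (Measure.pi fun _ : Fin n => μ) :=
    (integrable_of_abs_le (measurable_sampleRisk hfam.measurable_full)
      (abs_sampleRisk_le hfam.abs_full_le)).sub
      ((integrable_finsetSum _ fun i _ => integrable_of_abs_le (hfam.measurable_apply_self i)
        fun T => hfam.abs_loo_le i _).const_mul _)
  rw [e1, ← ofReal_integral_norm_eq_lintegral_enorm hint]
  refine ENNReal.ofReal_le_ofReal
    ((hfam.integral_abs_sampleRisk_sub_looRisk_le (μ := μ) hn).trans_eq ?_)
  congr 5 with i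
  exact (hfam.integral_abs_comp hJ i).symm

end Sample

/-! ### Consistency for bounded losses -/

section RiskError

/-- The `L¹` distance between the conditional risk of the loss `g` given the training data and its
leave-one-out estimator. -/
noncomputable def looRiskError {Ω : Type*} [MeasurableSpace Ω] {p n : ℕ} (𝒜 : PredAlg)
    (P : Measure Ω) (Z : Fin (n + 1) → Ω → Obs p) (g : ℝ → ℝ) : ENNReal :=
  ∫⁻ ω, ‖(P[fun ω' => g (newResponse Z ω' - fullPred 𝒜 Z ω') | trainingSigma Z]) ω
    - (1 / (n : ℝ)) * ∑ i : Fin n, g (looResidual 𝒜 Z i ω)‖ₑ ∂P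

/-- The effect on the loss `g` at the fresh point of removing one training point, averaged over the
training points. -/
noncomputable def avgRemovalEffect {Ω : Type*} [MeasurableSpace Ω] {p n : ℕ} (𝒜 : PredAlg)
    (P : Measure Ω) (Z : Fin (n + 1) → Ω → Obs p) (g : ℝ → ℝ) : ℝ :=
  (1 / (n : ℝ)) * ∑ i : Fin n,
    ∫ ω, |g (newResponse Z ω - fullPred 𝒜 Z ω) - g (newResponse Z ω - looPred 𝒜 Z i ω)| ∂P

variable {𝒜 : PredAlg} {p : ℕ → ℕ} {law : ∀ n, Measure (Obs (p n))} {Ω : ℕ → Type*}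
  [∀ n, MeasurableSpace (Ω n)] {P : ∀ n, Measure (Ω n)} [∀ n, IsProbabilityMeasure (P n)]
  {Z : ∀ n, Fin (n + 1) → Ω n → Obs (p n)}

theorem tendsto_looRiskError (h𝒜 : 𝒜.IsMeasurable)
    (hZ : ∀ n, 2 ≤ n → IsIIDSample (Z n) (law n) (P n)) {g : ℝ → ℝ} (hg : Measurable g) {B : ℝ}
    (hB : ∀ t, |g t| ≤ B)
    (h : Tendsto (fun n => avgRemovalEffect 𝒜 (P n) (Z n) g) atTop (𝓝 0)) :
    Tendsto (fun n => looRiskError 𝒜 (P n) (Z n) g) atTop (𝓝 0) := by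
  have h1 : Tendsto (fun n : ℕ => ENNReal.ofReal
      √(12 * B * avgRemovalEffect 𝒜 (P n) (Z n) g + 4 * B ^ 2 / n)) atTop (𝓝 0) := by
    have := (h.const_mul (12 * B)).add (tendsto_const_div_atTop_nhds_zero_nat (4 * B ^ 2))
    simpa using ENNReal.tendsto_ofReal (this.sqrt)
  refine tendsto_of_tendsto_of_tendsto_of_le_of_le' tendsto_const_nhds h1
    (Eventually.of_forall fun _ => zero_le) ?_
  filter_upwards [eventually_ge_atTop 2] with n hn
  exact (hZ n hn).lintegral_condExp_sub_le h𝒜 (by omega) hg hB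

theorem avgRemovalEffect_nonneg {Ω : Type*} [MeasurableSpace Ω] {p n : ℕ} (𝒜 : PredAlg)
    (P : Measure Ω) (Z : Fin (n + 1) → Ω → Obs p) (g : ℝ → ℝ) :
    0 ≤ avgRemovalEffect 𝒜 P Z g :=
  mul_nonneg (by positivity) (Finset.sum_nonneg fun _ _ => integral_nonneg fun _ => abs_nonneg _)

theorem average_le_const_add_average {n : ℕ} (hn : 0 < n) {a b : Fin n → ℝ} {c : ℝ}
    (h : ∀ i, a i ≤ c + b i) :
    (1 / (n : ℝ)) * ∑ i, a i ≤ c + (1 / (n : ℝ)) * ∑ i, b i := by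
  have hn' : (n : ℝ) ≠ 0 := by positivity
  calc (1 / (n : ℝ)) * ∑ i, a i ≤ (1 / (n : ℝ)) * ∑ i, (c + b i) := by gcongr with i; exact h i
    _ = _ := by simp [Finset.sum_add_distrib, mul_add, hn']

theorem tendsto_avgRemovalEffect_of_lipschitz (h𝒜 : 𝒜.IsMeasurable)
    (hZ : ∀ n, 2 ≤ n → IsIIDSample (Z n) (law n) (P n)) (hstab : IsOutOfSampleStable 𝒜 P Z)
    {g : ℝ → ℝ} {L : NNReal} (hg : LipschitzWith L g) {B : ℝ} (hB : ∀ t, |g t| ≤ B) :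
    Tendsto (fun n => avgRemovalEffect 𝒜 (P n) (Z n) g) atTop (𝓝 0) := by
  have hgm := hg.continuous.measurable
  have hB0 : 0 ≤ B := (abs_nonneg _).trans (hB 0)
  -- A perturbation of the prediction by less than `η` changes the loss by at most `L * η`.
  have key : ∀ η : ℝ, 0 < η → ∀ n, 2 ≤ n → avgRemovalEffect 𝒜 (P n) (Z n) g ≤ L * η +
      2 * B * ((1 / (n : ℝ)) * ∑ i : Fin n,
        (P n).real {ω | η ≤ |fullPred 𝒜 (Z n) ω - looPred 𝒜 (Z n) i ω|}) := by
    intro η hη n hn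
    rw [mul_left_comm, Finset.mul_sum]
    refine average_le_const_add_average (by omega) fun i => ?_
    have hr := (hZ n hn).measurable_freshError h𝒜
    have hl := (hZ n hn).measurable_looFreshError h𝒜 i
    have hset : MeasurableSet {ω | η ≤ |fullPred 𝒜 (Z n) ω - looPred 𝒜 (Z n) i ω|} := by
      have : Measurable fun ω => |fullPred 𝒜 (Z n) ω - looPred 𝒜 (Z n) i ω| := by
        simpa using (hl.sub hr).abs
      exact measurableSet_le measurable_const this
    have hi := ((integrable_of_abs_le (μ := P n) (hgm.comp hr) fun _ => hB _).sub
      (integrable_of_abs_le (hgm.comp hl) fun _ => hB _)).abs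
    have hind := (integrable_const (μ := P n) (2 * B)).indicator hset
    rw [mul_comm (2 * B), ← smul_eq_mul (Measure.real _ _) (2 * B),
      ← integral_indicator_const _ hset]
    have hc : ∫ _, (L : ℝ) * η ∂(P n) = L * η := by simp
    rw [← hc, ← integral_add (integrable_const _) hind]
    refine integral_mono hi ((integrable_const _).add hind) fun ω => ?_
    simp only [Set.indicator_apply, Set.mem_ofPred_eq]
    split_ifs with hω
    · have h1 := hB (newResponse (Z n) ω - fullPred 𝒜 (Z n) ω)
      have h2 := hB (newResponse (Z n) ω - looPred 𝒜 (Z n) i ω)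
      have h3 : 0 ≤ (L : ℝ) * η := by positivity
      refine (abs_sub _ _).trans ?_
      linarith
    · have h1 := hg.dist_le_mul (newResponse (Z n) ω - fullPred 𝒜 (Z n) ω)
        (newResponse (Z n) ω - looPred 𝒜 (Z n) i ω)
      rw [Real.dist_eq, Real.dist_eq, sub_sub_sub_cancel_left, abs_sub_comm (looPred _ _ _ _)] at h1
      rw [add_zero]
      exact h1.trans (by gcongr; exact (not_le.1 hω).le)
  refine tendsto_order.2 ⟨fun a ha => Eventually.of_forall fun n =>
    ha.trans_le (avgRemovalEffect_nonneg _ _ _ _), fun κ hκ => ?_⟩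
  have hη : 0 < κ / (2 * (L + 1)) := by positivity
  have hlim := (hstab _ hη).const_mul (2 * B)
  rw [mul_zero] at hlim
  filter_upwards [hlim.eventually (gt_mem_nhds (half_pos hκ)), eventually_ge_atTop 2] with n h1 h2
  refine (key _ hη n h2).trans_lt ?_
  have : (L : ℝ) * (κ / (2 * (L + 1))) ≤ κ / 2 := by
    rw [← sub_nonneg]
    have : κ / 2 - L * (κ / (2 * (L + 1))) = κ / (2 * (L + 1)) := by field_simp; ring
    rw [this]
    exact hη.le
  linarith

/-- Under stability, the leave-one-out estimator is consistent for every bounded Lipschitz loss. -/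
theorem tendsto_looRiskError_of_lipschitz (h𝒜 : 𝒜.IsMeasurable)
    (hZ : ∀ n, 2 ≤ n → IsIIDSample (Z n) (law n) (P n)) (hstab : IsOutOfSampleStable 𝒜 P Z)
    {g : ℝ → ℝ} {L : NNReal} (hg : LipschitzWith L g) {B : ℝ} (hB : ∀ t, |g t| ≤ B) :
    Tendsto (fun n => looRiskError 𝒜 (P n) (Z n) g) atTop (𝓝 0) :=
  tendsto_looRiskError h𝒜 hZ hg.continuous.measurable hB
    (tendsto_avgRemovalEffect_of_lipschitz h𝒜 hZ hstab hg hB)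

end RiskError

/-! ### Misclassification error -/

section Misclassification

/-- For a symmetric algorithm, all training points are equally likely to influence the prediction
at a fresh point. -/
theorem IsIIDSample.measureReal_fullPred_ne_looPred {Ω : Type*} [MeasurableSpace Ω] {p n : ℕ}
    {Z : Fin (n + 1) → Ω → Obs p} {μ : Measure (Obs p)} {P : Measure Ω} [IsProbabilityMeasure P]
    (hZ : IsIIDSample Z μ P) {𝒜 : PredAlg} (h𝒜 : 𝒜.IsMeasurable) (hsymm : 𝒜.IsSymmetric)
    (i : Fin n) :
    P.real {ω | fullPred 𝒜 Z ω ≠ looPred 𝒜 Z i ω}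
      = P.real {ω | fullPred 𝒜 Z ω ≠ looPred 𝒜 Z (n - 1) ω} := by
  have := hZ.isProbabilityMeasure_law
  cases n with
  | zero => exact i.elim0
  | succ m =>
    -- Moving the `i`-th entry of the sample to the last place preserves the law of the sample.
    let π : Equiv.Perm (Fin (m + 1)) :=
      (finSuccEquiv' (Fin.last m)).trans (finSuccEquiv' i).symm
    have hπ : MeasurePreserving (fun q : Obs p × (Fin (m + 1) → Obs p) => (q.1, q.2 ∘ π))
        (μ.prod (Measure.pi fun _ : Fin (m + 1) => μ))
        (μ.prod (Measure.pi fun _ : Fin (m + 1) => μ)) := by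
      have h := (measurePreserving_piFinSuccAbove (fun _ : Fin (m + 1) => μ) (Fin.last m)).symm.comp
        (measurePreserving_piFinSuccAbove (fun _ : Fin (m + 1) => μ) i)
      have e : ((MeasurableEquiv.piFinSuccAbove (fun _ : Fin (m + 1) => Obs p) (Fin.last m)).symm ∘
          MeasurableEquiv.piFinSuccAbove (fun _ : Fin (m + 1) => Obs p) i) = fun T => T ∘ π := by
        funext T
        change (Fin.last m).insertNth (T i) (i.removeNth T) = T ∘ π
        rw [Fin.insertNth_eq_iff]
        refine ⟨by simp [π], funext fun j => ?_⟩
        simp only [Fin.removeNth, π, Function.comp_apply, Equiv.trans_apply,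
          finSuccEquiv'_succAbove, finSuccEquiv'_symm_some]
      exact (MeasurePreserving.id μ).prod (e ▸ h)
    have hdrop : ∀ T : Fin (m + 1) → Obs p,
        dropObs (Fin.last m : ℕ) (T ∘ π) = dropObs (i : ℕ) T := fun T => by
      rw [dropObs_eq_removeNth, dropObs_eq_removeNth]
      funext j
      simp only [Fin.removeNth, π, Function.comp_apply, Equiv.trans_apply,
        finSuccEquiv'_succAbove, finSuccEquiv'_symm_some]
    have hJ := hZ.measurePreserving_freshAndTraining
    let S : Set (Obs p × (Fin (m + 1) → Obs p)) :=
      {q | predError 𝒜 q ≠ predError 𝒜 (dropPair (Fin.last m) q)}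
    have hS : MeasurableSet S := (measurableSet_eq_fun (measurable_predError h𝒜)
      ((measurable_predError h𝒜).comp (measurable_dropPair _))).compl
    have e1 : {ω | fullPred 𝒜 Z ω ≠ looPred 𝒜 Z (m + 1 - 1) ω} = freshAndTraining Z ⁻¹' S := by
      ext ω
      simp only [S, Set.mem_ofPred_eq, Set.mem_preimage, predError, dropPair, ne_eq, sub_right_inj,
        freshAndTraining]
      rfl
    have e2 : {ω | fullPred 𝒜 Z ω ≠ looPred 𝒜 Z i ω}
        = freshAndTraining Z ⁻¹' ((fun q => (q.1, q.2 ∘ π)) ⁻¹' S) := by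
      ext ω
      simp only [S, Set.mem_ofPred_eq, Set.mem_preimage, predError, dropPair, ne_eq, sub_right_inj,
        freshAndTraining]
      rw [hsymm, hdrop]
      rfl
    rw [e1, e2, measureReal_def, measureReal_def, hJ.measure_preimage hS.nullMeasurableSet,
      hJ.measure_preimage (hπ.measurable hS).nullMeasurableSet,
      hπ.measure_preimage hS.nullMeasurableSet]

/-- The zero-one loss. -/
noncomputable def zeroOneLoss : ℝ → ℝ := Set.indicator {t | t ≠ 0} fun _ => 1

theorem measurable_zeroOneLoss : Measurable zeroOneLoss :=
  measurable_const.indicator (measurableSet_singleton 0).compl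

theorem abs_zeroOneLoss_le (t : ℝ) : |zeroOneLoss t| ≤ 1 := by
  unfold zeroOneLoss
  by_cases h : t = 0 <;> simp [h]

variable {𝒜 : PredAlg} {p : ℕ → ℕ} {law : ∀ n, Measure (Obs (p n))} {Ω : ℕ → Type*}
  [∀ n, MeasurableSpace (Ω n)] {P : ∀ n, Measure (Ω n)} [∀ n, IsProbabilityMeasure (P n)]
  {Z : ∀ n, Fin (n + 1) → Ω n → Obs (p n)}

theorem tendsto_looRiskError_zeroOneLoss (h𝒜 : 𝒜.IsMeasurable) (hsymm : 𝒜.IsSymmetric)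
    (hZ : ∀ n, 2 ≤ n → IsIIDSample (Z n) (law n) (P n))
    (h : Tendsto (fun n : ℕ => P n {ω | fullPred 𝒜 (Z n) ω ≠ looPred 𝒜 (Z n) (n - 1) ω})
      atTop (𝓝 0)) :
    Tendsto (fun n => looRiskError 𝒜 (P n) (Z n) zeroOneLoss) atTop (𝓝 0) := by
  refine tendsto_looRiskError h𝒜 hZ measurable_zeroOneLoss abs_zeroOneLoss_le ?_
  have h' := (ENNReal.tendsto_toReal ENNReal.zero_ne_top).comp h
  refine squeeze_zero' (Eventually.of_forall fun n => avgRemovalEffect_nonneg _ _ _ _) ?_ h'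
  filter_upwards [eventually_ge_atTop 2] with n hn
  have hle : ∀ i : Fin n, ∫ ω, |zeroOneLoss (newResponse (Z n) ω - fullPred 𝒜 (Z n) ω)
      - zeroOneLoss (newResponse (Z n) ω - looPred 𝒜 (Z n) i ω)| ∂(P n)
      ≤ (P n).real {ω | fullPred 𝒜 (Z n) ω ≠ looPred 𝒜 (Z n) (n - 1) ω} + 0 := fun i => by
    have hr := (hZ n hn).measurable_freshError h𝒜
    have hl := (hZ n hn).measurable_looFreshError h𝒜 i
    have hset : MeasurableSet {ω | fullPred 𝒜 (Z n) ω ≠ looPred 𝒜 (Z n) i ω} := by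
      have := (measurableSet_eq_fun hr hl).compl
      convert this using 1
      ext ω
      simp
    rw [add_zero, ← (hZ n hn).measureReal_fullPred_ne_looPred h𝒜 hsymm i,
      ← integral_indicator_one hset]
    refine integral_mono ((integrable_of_abs_le (measurable_zeroOneLoss.comp hr)
      fun _ => abs_zeroOneLoss_le _).sub (integrable_of_abs_le (measurable_zeroOneLoss.comp hl)
      fun _ => abs_zeroOneLoss_le _)).abs ((integrable_const 1).indicator hset) fun ω => ?_
    by_cases hω : fullPred 𝒜 (Z n) ω = looPred 𝒜 (Z n) i ω
    · simp [hω]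
    · simp only [Set.indicator_apply, Set.mem_ofPred_eq, ne_eq, hω, not_false_eq_true, if_true,
        zeroOneLoss, Pi.one_apply]
      split_ifs <;> simp
  refine (average_le_const_add_average (by omega) hle).trans_eq ?_
  simp [measureReal_def]

end Misclassification

/-! ### Truncation and mean-squared prediction error -/

section Truncation

theorem lintegral_enorm_average_le {α : Type*} [MeasurableSpace α] {P : Measure α} {n : ℕ}
    (hn : 0 < n) {X : Fin n → α → ℝ} (hX : ∀ i, Measurable (X i)) {c : ENNReal}
    (hc : ∀ i, ∫⁻ ω, ‖X i ω‖ₑ ∂P ≤ c) :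
    ∫⁻ ω, ‖(1 / (n : ℝ)) * ∑ i, X i ω‖ₑ ∂P ≤ c := by
  calc ∫⁻ ω, ‖(1 / (n : ℝ)) * ∑ i, X i ω‖ₑ ∂P
      ≤ ∫⁻ ω, ‖1 / (n : ℝ)‖ₑ * ∑ i, ‖X i ω‖ₑ ∂P := by
        refine lintegral_mono fun ω => ?_
        rw [enorm_mul]
        gcongr
        exact enorm_sum_le _ _
    _ = ‖1 / (n : ℝ)‖ₑ * ∑ i, ∫⁻ ω, ‖X i ω‖ₑ ∂P := by
        rw [lintegral_const_mul _ (Finset.measurable_sum _ fun i _ => (hX i).enorm),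
          lintegral_finsetSum _ fun i _ => (hX i).enorm]
    _ ≤ ‖1 / (n : ℝ)‖ₑ * ∑ _i : Fin n, c := by gcongr with i; exact hc i
    _ = c := by
        rw [Finset.sum_const, Finset.card_univ, Fintype.card_fin, nsmul_eq_mul, ← mul_assoc,
          one_div, enorm_inv (by positivity), Real.enorm_natCast,
          ENNReal.inv_mul_cancel (by exact_mod_cast hn.ne') (ENNReal.natCast_ne_top n), one_mul]

theorem lintegral_enorm_condExp_le {α : Type*} {m m0 : MeasurableSpace α} (P : Measure α)
    (f : α → ℝ) : ∫⁻ ω, ‖(P[f | m]) ω‖ₑ ∂P ≤ ∫⁻ ω, ‖f ω‖ₑ ∂P := by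
  simpa only [eLpNorm_one_eq_lintegral_enorm] using eLpNorm_condExp_le_eLpNorm (μ := P) f le_rfl

/-- Replacing a loss `f` by a bounded loss `g` changes the error of the leave-one-out estimator by
at most the sum of the mean errors of the replacement with and without the last point. -/
theorem IsIIDSample.looRiskError_le_add {Ω : Type*} [MeasurableSpace Ω] {p n : ℕ}
    {Z : Fin (n + 1) → Ω → Obs p} {μ : Measure (Obs p)} {P : Measure Ω} [IsProbabilityMeasure P]
    (hZ : IsIIDSample Z μ P) (hn : 0 < n) {𝒜 : PredAlg} (h𝒜 : 𝒜.IsMeasurable) {f g : ℝ → ℝ}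
    (hf : Measurable f) (hg : Measurable g) {B : ℝ} (hB : ∀ t, |g t| ≤ B) {c d : ENNReal}
    (hc : ∫⁻ ω, ‖f (newResponse Z ω - fullPred 𝒜 Z ω)
      - g (newResponse Z ω - fullPred 𝒜 Z ω)‖ₑ ∂P ≤ c) (hc' : c ≠ ⊤)
    (hd : ∫⁻ ω, ‖f (newResponse Z ω - looPred 𝒜 Z (n - 1) ω)
      - g (newResponse Z ω - looPred 𝒜 Z (n - 1) ω)‖ₑ ∂P ≤ d) :
    looRiskError 𝒜 P Z f ≤ looRiskError 𝒜 P Z g + c + d := by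
  have hr := hZ.measurable_freshError h𝒜
  have hu := hZ.measurable_looResidual h𝒜
  set r := fun ω => newResponse Z ω - fullPred 𝒜 Z ω
  have hgi : Integrable (fun ω => g (r ω)) P := integrable_of_abs_le (hg.comp hr) fun _ => hB _
  have hdi : Integrable (fun ω => f (r ω) - g (r ω)) P :=
    ⟨((hf.comp hr).sub (hg.comp hr)).aestronglyMeasurable, hc.trans_lt hc'.lt_top⟩
  have hfi : Integrable (fun ω => f (r ω)) P := by
    refine (hgi.add hdi).congr (Eventually.of_forall fun ω => ?_)
    simp
  have hsplit : P[fun ω => f (r ω) - g (r ω) | trainingSigma Z] =ᵐ[P]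
      P[fun ω => f (r ω) | trainingSigma Z] - P[fun ω => g (r ω) | trainingSigma Z] :=
    condExp_sub hfi hgi _
  have hfg : ∀ i, Measurable fun ω => g (looResidual 𝒜 Z i ω) - f (looResidual 𝒜 Z i ω) :=
    fun i => (hg.comp (hu i)).sub (hf.comp (hu i))
  have hX : AEMeasurable (fun ω => ‖(P[fun ω' => g (r ω') | trainingSigma Z]) ω
      - (1 / (n : ℝ)) * ∑ i : Fin n, g (looResidual 𝒜 Z i ω)‖ₑ) P :=
    (integrable_condExp.aemeasurable.sub ((Finset.measurable_sum _ fun i _ =>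
      hg.comp (hu i)).const_mul _).aemeasurable).enorm
  calc looRiskError 𝒜 P Z f
      ≤ ∫⁻ ω, (‖(P[fun ω' => g (r ω') | trainingSigma Z]) ω
          - (1 / (n : ℝ)) * ∑ i : Fin n, g (looResidual 𝒜 Z i ω)‖ₑ
        + ‖(P[fun ω' => f (r ω') - g (r ω') | trainingSigma Z]) ω‖ₑ
        + ‖(1 / (n : ℝ)) * ∑ i : Fin n,
            (g (looResidual 𝒜 Z i ω) - f (looResidual 𝒜 Z i ω))‖ₑ) ∂P := by
        refine lintegral_mono_ae ?_
        filter_upwards [hsplit] with ω hω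
        rw [hω]
        refine le_trans (le_of_eq ?_)
          ((enorm_add_le _ _).trans (by gcongr; exact enorm_add_le _ _))
        simp only [Pi.sub_apply, Finset.sum_sub_distrib]
        congr 1
        ring
    _ = looRiskError 𝒜 P Z g
        + ∫⁻ ω, ‖(P[fun ω' => f (r ω') - g (r ω') | trainingSigma Z]) ω‖ₑ ∂P
        + ∫⁻ ω, ‖(1 / (n : ℝ)) * ∑ i : Fin n,
            (g (looResidual 𝒜 Z i ω) - f (looResidual 𝒜 Z i ω))‖ₑ ∂P := by
        rw [lintegral_add_left' (by exact hX.add integrable_condExp.aemeasurable.enorm),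
          lintegral_add_left' hX]
        rfl
    _ ≤ looRiskError 𝒜 P Z g + c + d := by
        gcongr
        · exact (lintegral_enorm_condExp_le P _).trans hc
        · refine lintegral_enorm_average_le hn hfg fun i => le_trans (le_of_eq ?_) hd
          rw [hZ.lintegral_looResidual h𝒜 (F := fun t => ‖g t - f t‖ₑ) (hg.sub hf).enorm i
            ⟨n - 1, by omega⟩]
          simp_rw [enorm_sub_rev (g _)]

/-- The square, cut off at height `M ^ 2`. -/
noncomputable def truncSq (M t : ℝ) : ℝ := min |t| M ^ 2

theorem abs_truncSq_le {M : ℝ} (hM : 0 ≤ M) (t : ℝ) : |truncSq M t| ≤ M ^ 2 := by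
  have h : 0 ≤ min |t| M := le_min (abs_nonneg t) hM
  rw [truncSq, abs_of_nonneg (by positivity)]
  gcongr
  exact min_le_right _ _

theorem lipschitzWith_truncSq (M : NNReal) : LipschitzWith (2 * M) (truncSq M) := by
  refine LipschitzWith.of_dist_le_mul fun s t => ?_
  have hs : 0 ≤ min |s| (M : ℝ) := le_min (abs_nonneg s) M.2
  have ht : 0 ≤ min |t| (M : ℝ) := le_min (abs_nonneg t) M.2
  have h1 : |min |s| (M : ℝ) - min |t| M| ≤ |s - t| := by
    refine (abs_min_sub_min_le_max _ _ _ _).trans ?_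
    rw [sub_self, abs_zero]
    exact max_le (abs_abs_sub_abs_le s t) (abs_nonneg _)
  have h2 : |min |s| (M : ℝ) + min |t| M| ≤ 2 * M := by
    rw [abs_of_nonneg (by positivity)]
    linarith [min_le_right |s| (M : ℝ), min_le_right |t| (M : ℝ)]
  rw [Real.dist_eq, Real.dist_eq, truncSq, truncSq, sq_sub_sq, abs_mul]
  push_cast
  exact mul_le_mul h2 h1 (abs_nonneg _) (by positivity)

theorem enorm_sq_sub_truncSq_le {M ξ : ℝ} (hM : 0 < M) (hξ : 0 < ξ) (t : ℝ) :
    ‖t ^ 2 - truncSq M t‖ₑ ≤ ENNReal.ofReal (M ^ (-ξ)) * ‖t‖ₑ ^ (2 + ξ) := by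
  rcases le_total |t| M with h | h
  · simp [truncSq, min_eq_left h]
  · have ht : 0 < |t| := hM.trans_le h
    have h0 : 0 ≤ t ^ 2 - truncSq M t := by
      rw [truncSq, min_eq_right h, ← sq_abs]
      have := pow_le_pow_left₀ hM.le h 2
      linarith
    rw [Real.enorm_eq_ofReal h0, ← ofReal_norm, Real.norm_eq_abs,
      ENNReal.ofReal_rpow_of_nonneg ht.le (by linarith), ← ENNReal.ofReal_mul (by positivity)]
    refine ENNReal.ofReal_le_ofReal ?_
    have h1 : t ^ 2 - truncSq M t ≤ |t| ^ 2 := by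
      rw [truncSq, sq_abs]
      linarith [sq_nonneg (min |t| M)]
    have h2 : 1 ≤ M ^ (-ξ) * |t| ^ ξ := by
      rw [Real.rpow_neg hM.le, inv_mul_eq_div, one_le_div (by positivity)]
      exact Real.rpow_le_rpow hM.le h hξ.le
    rw [Real.rpow_add ht, Real.rpow_two, mul_left_comm]
    exact h1.trans (le_mul_of_one_le_right (by positivity) h2)

variable {𝒜 : PredAlg} {p : ℕ → ℕ} {law : ∀ n, Measure (Obs (p n))} {Ω : ℕ → Type*}
  [∀ n, MeasurableSpace (Ω n)] {P : ∀ n, Measure (Ω n)}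
  {Z : ∀ n, Fin (n + 1) → Ω n → Obs (p n)}

theorem BoundedMoments.eventually_lintegral_sub_truncSq_le {X : ∀ n, Ω n → ℝ} {ξ : ℝ} (hξ : 0 < ξ)
    (hX : BoundedMoments P X (2 + ξ)) {κ : ENNReal} (hκ : 0 < κ) :
    ∀ᶠ M : ℝ in atTop, ∀ n, 2 ≤ n → ∫⁻ ω, ‖X n ω ^ 2 - truncSq M (X n ω)‖ₑ ∂(P n) ≤ κ := by
  obtain ⟨C, hC⟩ := hX
  have hlim : Tendsto (fun M : ℝ => ENNReal.ofReal (M ^ (-ξ)) * C) atTop (𝓝 0) := by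
    have := ENNReal.Tendsto.mul_const (b := (C : ENNReal))
      (ENNReal.tendsto_ofReal (tendsto_rpow_neg_atTop hξ)) (Or.inr ENNReal.coe_ne_top)
    simpa using this
  filter_upwards [hlim.eventually (gt_mem_nhds hκ), eventually_gt_atTop 0] with M hM hM0 n hn
  calc ∫⁻ ω, ‖X n ω ^ 2 - truncSq M (X n ω)‖ₑ ∂(P n)
      ≤ ∫⁻ ω, ENNReal.ofReal (M ^ (-ξ)) * ‖X n ω‖ₑ ^ (2 + ξ) ∂(P n) :=
        lintegral_mono fun ω => enorm_sq_sub_truncSq_le hM0 hξ _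
    _ = ENNReal.ofReal (M ^ (-ξ)) * ∫⁻ ω, ‖X n ω‖ₑ ^ (2 + ξ) ∂(P n) :=
        lintegral_const_mul' _ _ ENNReal.ofReal_ne_top
    _ ≤ ENNReal.ofReal (M ^ (-ξ)) * C := by gcongr; exact hC n hn
    _ ≤ κ := hM.le

theorem tendsto_looRiskError_sq [∀ n, IsProbabilityMeasure (P n)] (h𝒜 : 𝒜.IsMeasurable)
    (hZ : ∀ n, 2 ≤ n → IsIIDSample (Z n) (law n) (P n)) (hstab : IsOutOfSampleStable 𝒜 P Z)
    {ξ : ℝ} (hξ : 0 < ξ)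
    (hfull : BoundedMoments P (fun n ω => newResponse (Z n) ω - fullPred 𝒜 (Z n) ω) (2 + ξ))
    (hloo : BoundedMoments P
      (fun n ω => newResponse (Z n) ω - looPred 𝒜 (Z n) (n - 1) ω) (2 + ξ)) :
    Tendsto (fun n => looRiskError 𝒜 (P n) (Z n) fun t => t ^ 2) atTop (𝓝 0) := by
  refine ENNReal.tendsto_nhds_zero.2 fun κ hκ => ?_
  rcases eq_or_ne κ ⊤ with rfl | hκt
  · exact Eventually.of_forall fun _ => le_top
  have hκ3 : 0 < κ / 3 := ENNReal.div_pos hκ.ne' (by simp)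
  obtain ⟨M, h1, h2, hM⟩ := ((hfull.eventually_lintegral_sub_truncSq_le hξ hκ3).and
    ((hloo.eventually_lintegral_sub_truncSq_le hξ hκ3).and (eventually_ge_atTop 0))).exists
  have hlim := tendsto_looRiskError_of_lipschitz h𝒜 hZ hstab (lipschitzWith_truncSq ⟨M, hM⟩)
    (abs_truncSq_le hM)
  filter_upwards [ENNReal.tendsto_nhds_zero.1 hlim _ hκ3, eventually_ge_atTop 2] with n hn hn2
  refine ((hZ n hn2).looRiskError_le_add (by omega) h𝒜 (by fun_prop)
    (lipschitzWith_truncSq ⟨M, hM⟩).continuous.measurable (abs_truncSq_le hM) (h1 n hn2)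
    (ENNReal.div_lt_top hκt (by simp)).ne (h2 n hn2)).trans ?_
  calc _ ≤ κ / 3 + κ / 3 + κ / 3 := by gcongr
    _ = κ := ENNReal.add_thirds κ

end Truncation

/-! ### Sandwich bound for monotone losses -/

section Sandwich

/-- A bounded monotone function and its translate are separated by a Lipschitz function. -/
theorem Monotone.exists_lipschitzWith_between {f : ℝ → ℝ} (hf : Monotone f) {a b ε : ℝ}
    (ha : ∀ t, a ≤ f t) (hb : ∀ t, f t ≤ b) (hε : 0 < ε) :
    ∃ (g : ℝ → ℝ) (L : NNReal), LipschitzWith L g ∧ ∀ t, f t ≤ g t ∧ g t ≤ f (t + ε) := by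
  have hab : 0 ≤ (b - a) / ε := div_nonneg (by linarith [ha 0, hb 0]) hε.le
  -- The slope makes `L * ε` equal to `b - a`, so in the supremum below a point beyond `t + ε`
  -- contributes at most `a`.
  obtain ⟨L, hL⟩ : ∃ L : NNReal, (L : ℝ) = (b - a) / ε := ⟨⟨_, hab⟩, rfl⟩
  have hLε : L * ε = b - a := by rw [hL]; field_simp
  have hbdd : ∀ t, BddAbove (Set.range fun s => f s - L * |s - t|) := fun t => by
    refine ⟨b, ?_⟩
    rintro _ ⟨s, rfl⟩
    have : 0 ≤ (L : ℝ) * |s - t| := by positivity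
    linarith [hb s]
  refine ⟨fun t => ⨆ s, (f s - L * |s - t|), L, LipschitzWith.of_le_add_mul L fun t s => ?_,
    fun t => ⟨?_, ciSup_le fun s => ?_⟩⟩
  · refine ciSup_le fun u => ?_
    have h1 := le_ciSup (hbdd s) u
    have h2 : (L : ℝ) * |u - s| ≤ L * |u - t| + L * |t - s| := by
      rw [← mul_add]
      gcongr
      exact abs_sub_le _ _ _
    rw [Real.dist_eq]
    linarith
  · simpa using le_ciSup (hbdd t) t
  · rcases le_total s (t + ε) with h | h
    · have : 0 ≤ (L : ℝ) * |s - t| := by positivity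
      linarith [hf h]
    · have : L * ε ≤ L * |s - t| := by
        gcongr
        exact (by linarith : ε ≤ s - t).trans (le_abs_self _)
      linarith [hb s, ha (t + ε)]

/-- The part of a loss `ℓ` exceeding the height `M`, at the modulus of the argument. -/
noncomputable def lossExcess (ℓ : ℝ → ℝ) (M t : ℝ) : ℝ := max (ℓ |t| - M) 0

theorem measurable_lossExcess {ℓ : ℝ → ℝ} (hℓ : Monotone ℓ) (M : ℝ) :
    Measurable (lossExcess ℓ M) :=
  ((hℓ.measurable.comp measurable_norm).sub_const M).max measurable_const

theorem lintegral_lossExcess_le {α : Type*} [MeasurableSpace α] {P : Measure α} {X : α → ℝ}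
    (hX : Measurable X) {ℓ : ℝ → ℝ} (hℓ : Monotone ℓ) {M : ℝ} (hM : 0 ≤ M) :
    ∫⁻ ω, ‖lossExcess ℓ M (X ω)‖ₑ ∂P ≤ ∫⁻ ω in {ω | M ≤ |ℓ (|X ω|)|}, ‖ℓ |X ω|‖ₑ ∂P := by
  have hm : Measurable fun ω => ℓ |X ω| := hℓ.measurable.comp hX.abs
  rw [← lintegral_indicator (measurableSet_le measurable_const hm.abs)]
  refine lintegral_mono fun ω => ?_
  rcases le_total (ℓ |X ω|) M with h | h
  · simp [lossExcess, max_eq_right (sub_nonpos.2 h)]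
  · have h0 : 0 ≤ ℓ |X ω| := hM.trans h
    have hω : ω ∈ {ω | M ≤ |ℓ (|X ω|)|} := by
      rw [Set.mem_ofPred_eq, abs_of_nonneg h0]
      exact h
    rw [Set.indicator_of_mem hω, lossExcess,
      max_eq_left (sub_nonneg.2 h), Real.enorm_eq_ofReal (sub_nonneg.2 h), Real.enorm_eq_ofReal h0]
    exact ENNReal.ofReal_le_ofReal (by linarith)

theorem measure_abs_ge_le {α : Type*} [MeasurableSpace α] {P : Measure α} {X : α → ℝ}
    (hX : AEMeasurable X P) {c : ℝ} (hc : 0 < c) :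
    P {ω | c ≤ |X ω|} ≤ (∫⁻ ω, ‖X ω‖ₑ ∂P) / ENNReal.ofReal c := by
  refine le_trans (measure_mono fun ω hω => ?_) (meas_ge_le_lintegral_div hX.enorm
    (ENNReal.ofReal_pos.2 hc).ne' ENNReal.ofReal_ne_top)
  change ENNReal.ofReal c ≤ ‖X ω‖ₑ
  rw [Real.enorm_eq_ofReal_abs]
  exact ENNReal.ofReal_le_ofReal hω

/-- A loss `ℓ` is clipped to a bounded interval; `g` and `g'` are Lipschitz functions between the
clipped loss and its translates. Outside the sandwich event, one of the leave-one-out errors of `g`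
and `g'`, or one of the two averages of the excess of `ℓ` over the clipping height, is large. -/
theorem IsIIDSample.measure_compl_sandwich_le {Ω : Type*} [MeasurableSpace Ω] {p n : ℕ}
    {Z : Fin (n + 1) → Ω → Obs p} {μ : Measure (Obs p)} {P : Measure Ω} [IsProbabilityMeasure P]
    (hZ : IsIIDSample Z μ P) (hn : 0 < n) {𝒜 : PredAlg} (h𝒜 : 𝒜.IsMeasurable) {ℓ : ℝ → ℝ}
    (hℓ : Monotone ℓ) {ε M : ℝ} (hε : 0 < ε) (hM : ℓ (-ε) ≤ M) {g g' : ℝ → ℝ}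
    (hg : Measurable g) (hg' : Measurable g')
    (hfg : ∀ t, max (ℓ (-ε)) (min (ℓ t) M) ≤ g t)
    (hgf : ∀ t, g t ≤ max (ℓ (-ε)) (min (ℓ (t + ε)) M))
    (hfg' : ∀ t, max (ℓ (-ε)) (min (ℓ (t - ε)) M) ≤ g' t)
    (hgf' : ∀ t, g' t ≤ max (ℓ (-ε)) (min (ℓ t) M))
    {c d : ENNReal} (hc' : c ≠ ⊤)
    (hc : ∫⁻ ω, ‖lossExcess ℓ M (newResponse Z ω - fullPred 𝒜 Z ω)‖ₑ ∂P ≤ c)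
    (hd : ∫⁻ ω, ‖lossExcess ℓ M (newResponse Z ω - looPred 𝒜 Z (n - 1) ω)‖ₑ ∂P ≤ d) :
    P {ω | (1 / (n : ℝ)) * ∑ i : Fin n, ℓ (|looResidual 𝒜 Z i ω| - ε) - ε
            ≤ (P[fun ω' => ℓ |newResponse Z ω' - fullPred 𝒜 Z ω'| | trainingSigma Z]) ω ∧
          (P[fun ω' => ℓ |newResponse Z ω' - fullPred 𝒜 Z ω'| | trainingSigma Z]) ω
            ≤ (1 / (n : ℝ)) * ∑ i : Fin n, ℓ (|looResidual 𝒜 Z i ω| + ε) + ε}ᶜ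
      ≤ (looRiskError 𝒜 P Z (fun t => g |t|) + looRiskError 𝒜 P Z (fun t => g' |t|) + c + d)
        / ENNReal.ofReal (ε / 2) := by
  have hr := hZ.measurable_freshError h𝒜
  have hu := hZ.measurable_looResidual h𝒜
  set r := fun ω => newResponse Z ω - fullPred 𝒜 Z ω
  set f : ℝ → ℝ := fun t => max (ℓ (-ε)) (min (ℓ t) M)
  have hfm : Measurable f := measurable_const.max (hℓ.measurable.min measurable_const)
  have hfB : ∀ t, |f t| ≤ max |ℓ (-ε)| |M| := fun t =>
    abs_le_max_abs_abs (le_max_left _ _) (max_le hM (min_le_right _ _))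
  have hfi : Integrable (fun ω => f |r ω|) P :=
    integrable_of_abs_le (hfm.comp hr.abs) fun _ => hfB _
  have hgB : ∀ t, |g t| ≤ max |ℓ (-ε)| |M| := fun t =>
    abs_le_max_abs_abs ((le_max_left _ _).trans (hfg t))
      ((hgf t).trans (max_le hM (min_le_right _ _)))
  have hgB' : ∀ t, |g' t| ≤ max |ℓ (-ε)| |M| := fun t =>
    abs_le_max_abs_abs ((le_max_left _ _).trans (hfg' t))
      ((hgf' t).trans (max_le hM (min_le_right _ _)))
  have hgi : Integrable (fun ω => g |r ω|) P :=
    integrable_of_abs_le (hg.comp hr.abs) fun _ => hgB _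
  have hgi' : Integrable (fun ω => g' |r ω|) P :=
    integrable_of_abs_le (hg'.comp hr.abs) fun _ => hgB' _
  have hτm := measurable_lossExcess hℓ M
  have hτi : Integrable (fun ω => lossExcess ℓ M (r ω)) P :=
    ⟨(hτm.comp hr).aestronglyMeasurable, hc.trans_lt hc'.lt_top⟩
  -- The clipping does not act from below at arguments larger than `-ε`.
  have hclip : ∀ t, -ε ≤ t → f t = min (ℓ t) M := fun t ht =>
    max_eq_right (le_min (hℓ ht) hM)
  have hadd : ∀ t, ℓ |t| = f |t| + lossExcess ℓ M t := fun t => by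
    rw [hclip _ (by linarith [abs_nonneg t]), lossExcess]
    rcases le_total (ℓ |t|) M with h | h
    · rw [min_eq_left h, max_eq_right (by linarith), add_zero]
    · rw [min_eq_right h, max_eq_left (by linarith)]; ring
  have hfle : ∀ t, -ε ≤ t → f t ≤ ℓ t := fun t ht => (hclip t ht).trans_le (min_le_left _ _)
  have hsub : ∀ t, ℓ (|t| - ε) ≤ f (|t| - ε) + lossExcess ℓ M t := fun t => by
    rw [hclip _ (by linarith [abs_nonneg t]), lossExcess]
    rcases le_total (ℓ (|t| - ε)) M with h | h
    · rw [min_eq_left h]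
      linarith [le_max_right (ℓ |t| - M) 0]
    · rw [min_eq_right h]
      linarith [le_max_left (ℓ |t| - M) 0, hℓ (by linarith : |t| - ε ≤ |t|)]
  have hℓi : Integrable (fun ω => ℓ |r ω|) P := by
    simp_rw [hadd]
    exact hfi.add hτi
  have hsplit : P[fun ω => ℓ |r ω| | trainingSigma Z] =ᵐ[P]
      P[fun ω => f |r ω| | trainingSigma Z]
        + P[fun ω => lossExcess ℓ M (r ω) | trainingSigma Z] := by
    simp_rw [hadd]
    exact condExp_add hfi hτi _
  have hup : P[fun ω => f |r ω| | trainingSigma Z] ≤ᵐ[P] P[fun ω => g |r ω| | trainingSigma Z] :=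
    condExp_mono hfi hgi (Eventually.of_forall fun ω => hfg _)
  have hlow : P[fun ω => g' |r ω| | trainingSigma Z] ≤ᵐ[P]
      P[fun ω => ℓ |r ω| | trainingSigma Z] :=
    condExp_mono hgi' hℓi (Eventually.of_forall fun ω =>
      (hgf' _).trans (hfle _ (by linarith [abs_nonneg (r ω)])))
  let X₁ := fun ω => (P[fun ω' => g |r ω'| | trainingSigma Z]) ω
    - (1 / (n : ℝ)) * ∑ i : Fin n, g |looResidual 𝒜 Z i ω|
  let X₂ := fun ω => (P[fun ω' => g' |r ω'| | trainingSigma Z]) ω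
    - (1 / (n : ℝ)) * ∑ i : Fin n, g' |looResidual 𝒜 Z i ω|
  let X₃ := P[fun ω => lossExcess ℓ M (r ω) | trainingSigma Z]
  let X₄ := fun ω => (1 / (n : ℝ)) * ∑ i : Fin n, lossExcess ℓ M (looResidual 𝒜 Z i ω)
  have hX₁ : AEMeasurable X₁ P := integrable_condExp.aemeasurable.sub
    ((Finset.measurable_sum _ fun i _ => hg.comp (hu i).abs).const_mul _).aemeasurable
  have hX₂ : AEMeasurable X₂ P := integrable_condExp.aemeasurable.sub
    ((Finset.measurable_sum _ fun i _ => hg'.comp (hu i).abs).const_mul _).aemeasurable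
  have hX₃ : AEMeasurable X₃ P := integrable_condExp.aemeasurable
  have hX₄ : AEMeasurable X₄ P :=
    ((Finset.measurable_sum _ fun i _ => hτm.comp (hu i)).const_mul _).aemeasurable
  have hI₃ : ∫⁻ ω, ‖X₃ ω‖ₑ ∂P ≤ c := (lintegral_enorm_condExp_le P _).trans hc
  have hI₄ : ∫⁻ ω, ‖X₄ ω‖ₑ ∂P ≤ d :=
    lintegral_enorm_average_le hn (fun i => hτm.comp (hu i)) fun i =>
      (hZ.lintegral_looResidual h𝒜 (F := fun t => ‖lossExcess ℓ M t‖ₑ) hτm.enorm i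
        ⟨n - 1, by omega⟩).trans_le hd
  have hε2 : 0 < ε / 2 := half_pos hε
  have hcover : ∀ᵐ ω ∂P, ω ∈ {ω | (1 / (n : ℝ)) * ∑ i : Fin n, ℓ (|looResidual 𝒜 Z i ω| - ε) - ε
            ≤ (P[fun ω' => ℓ |r ω'| | trainingSigma Z]) ω ∧
          (P[fun ω' => ℓ |r ω'| | trainingSigma Z]) ω
            ≤ (1 / (n : ℝ)) * ∑ i : Fin n, ℓ (|looResidual 𝒜 Z i ω| + ε) + ε}ᶜ
      → ω ∈ (({ω | ε / 2 ≤ |X₁ ω|} ∪ {ω | ε / 2 ≤ |X₂ ω|}) ∪ {ω | ε / 2 ≤ |X₃ ω|})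
        ∪ {ω | ε / 2 ≤ |X₄ ω|} := by
    filter_upwards [hsplit, hup, hlow] with ω h1 h2 h3 hω
    by_contra hcon
    simp only [Set.mem_union, Set.mem_ofPred_eq, not_or, not_le] at hcon
    obtain ⟨⟨⟨k1, k2⟩, k3⟩, k4⟩ := hcon
    refine hω ⟨?_, ?_⟩
    · have s1 : (1 / (n : ℝ)) * ∑ i : Fin n, ℓ (|looResidual 𝒜 Z i ω| - ε)
          ≤ (1 / (n : ℝ)) * ∑ i : Fin n, g' |looResidual 𝒜 Z i ω| + X₄ ω := by
        rw [← mul_add, ← Finset.sum_add_distrib]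
        gcongr with i
        exact (hsub _).trans (by gcongr; exact hfg' _)
      have s2 := (abs_lt.1 k2).1
      have s4 := (abs_lt.1 k4).2
      change -(ε / 2) < _ - _ at s2
      linarith
    · have s1 : (1 / (n : ℝ)) * ∑ i : Fin n, g |looResidual 𝒜 Z i ω|
          ≤ (1 / (n : ℝ)) * ∑ i : Fin n, ℓ (|looResidual 𝒜 Z i ω| + ε) := by
        gcongr with i
        exact (hgf _).trans (hfle _ (by linarith [abs_nonneg (looResidual 𝒜 Z i ω)]))
      have s2 := (abs_lt.1 k1).2
      have s3 := (abs_lt.1 k3).2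
      change _ - _ < ε / 2 at s2
      rw [Pi.add_apply] at h1
      change _ = _ + X₃ ω at h1
      linarith
  refine (measure_mono_ae hcover).trans ?_
  simp only [ENNReal.add_div]
  refine (measure_union_le _ _).trans (add_le_add ((measure_union_le _ _).trans
    (add_le_add ((measure_union_le _ _).trans (add_le_add ?_ ?_)) ?_)) ?_)
  · exact measure_abs_ge_le hX₁ hε2
  · exact measure_abs_ge_le hX₂ hε2
  · exact (measure_abs_ge_le hX₃ hε2).trans (by gcongr)
  · exact (measure_abs_ge_le hX₄ hε2).trans (by gcongr)

variable {𝒜 : PredAlg} {p : ℕ → ℕ} {law : ∀ n, Measure (Obs (p n))} {Ω : ℕ → Type*}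
  [∀ n, MeasurableSpace (Ω n)] {P : ∀ n, Measure (Ω n)}
  {Z : ∀ n, Fin (n + 1) → Ω n → Obs (p n)}

theorem UnifIntegrableSeq.eventually_lintegral_tail_le {X : ∀ n, Ω n → ℝ}
    (hX : UnifIntegrableSeq P X) {κ : ℝ} (hκ : 0 < κ) : ∀ᶠ M : ℝ in atTop, ∀ n, 2 ≤ n →
      ∫⁻ ω in {ω | M ≤ |X n ω|}, ‖X n ω‖ₑ ∂(P n) ≤ ENNReal.ofReal κ := by
  obtain ⟨M₀, hM₀⟩ := hX κ hκ
  filter_upwards [eventually_ge_atTop M₀] with M hM n hn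
  exact (lintegral_mono_set fun ω (hω : M ≤ _) => hM.trans hω).trans (hM₀ n hn)

theorem tendsto_measure_sandwich [∀ n, IsProbabilityMeasure (P n)] (h𝒜 : 𝒜.IsMeasurable)
    (hZ : ∀ n, 2 ≤ n → IsIIDSample (Z n) (law n) (P n)) (hstab : IsOutOfSampleStable 𝒜 P Z)
    {ℓ : ℝ → ℝ} (hℓ : Monotone ℓ)
    (hfull : UnifIntegrableSeq P (fun n ω => ℓ |newResponse (Z n) ω - fullPred 𝒜 (Z n) ω|))
    (hloo : UnifIntegrableSeq P
      (fun n ω => ℓ |newResponse (Z n) ω - looPred 𝒜 (Z n) (n - 1) ω|)) {ε : ℝ} (hε : 0 < ε) :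
    Tendsto (fun n : ℕ => P n {ω |
        (1 / (n : ℝ)) * ∑ i : Fin n, ℓ (|looResidual 𝒜 (Z n) i ω| - ε) - ε
          ≤ ((P n)[fun ω' => ℓ |newResponse (Z n) ω' - fullPred 𝒜 (Z n) ω'| |
              trainingSigma (Z n)]) ω ∧
        ((P n)[fun ω' => ℓ |newResponse (Z n) ω' - fullPred 𝒜 (Z n) ω'| |
              trainingSigma (Z n)]) ω
          ≤ (1 / (n : ℝ)) * ∑ i : Fin n, ℓ (|looResidual 𝒜 (Z n) i ω| + ε) + ε})
      atTop (𝓝 1) := by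
  set S : ∀ n, Set (Ω n) := fun n => {ω |
        (1 / (n : ℝ)) * ∑ i : Fin n, ℓ (|looResidual 𝒜 (Z n) i ω| - ε) - ε
          ≤ ((P n)[fun ω' => ℓ |newResponse (Z n) ω' - fullPred 𝒜 (Z n) ω'| |
              trainingSigma (Z n)]) ω ∧
        ((P n)[fun ω' => ℓ |newResponse (Z n) ω' - fullPred 𝒜 (Z n) ω'| |
              trainingSigma (Z n)]) ω
          ≤ (1 / (n : ℝ)) * ∑ i : Fin n, ℓ (|looResidual 𝒜 (Z n) i ω| + ε) + ε}
  have hε2 : 0 < ε / 2 := half_pos hε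
  suffices hcompl : Tendsto (fun n => P n (S n)ᶜ) atTop (𝓝 0) by
    have h1 : Tendsto (fun n => 1 - P n (S n)ᶜ) atTop (𝓝 1) := by
      simpa using ENNReal.Tendsto.sub tendsto_const_nhds hcompl (Or.inl ENNReal.one_ne_top)
    refine tendsto_of_tendsto_of_tendsto_of_le_of_le h1 tendsto_const_nhds (fun n => ?_)
      fun n => prob_le_one
    rw [tsub_le_iff_right, ← measure_univ (μ := P n), ← Set.union_compl_self (S n)]
    exact measure_union_le _ _
  refine ENNReal.tendsto_nhds_zero.2 fun κ hκ => ?_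
  -- The four contributions to the failure probability are each made smaller than `η`.
  obtain ⟨η, hη, hηκ⟩ : ∃ η : ℝ, 0 < η ∧
      (ENNReal.ofReal η + ENNReal.ofReal η + ENNReal.ofReal η + ENNReal.ofReal η)
        / ENNReal.ofReal (ε / 2) ≤ κ := by
    have hlim : Tendsto (fun η : ℝ => (ENNReal.ofReal η + ENNReal.ofReal η + ENNReal.ofReal η
        + ENNReal.ofReal η) / ENNReal.ofReal (ε / 2)) (𝓝[>] 0) (𝓝 0) := by
      have h0 : Tendsto (fun η : ℝ => ENNReal.ofReal η) (𝓝[>] 0) (𝓝 0) := by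
        simpa using ENNReal.tendsto_ofReal
          (tendsto_nhdsWithin_of_tendsto_nhds (a := (0 : ℝ)) (s := Set.Ioi 0)
            tendsto_id)
      have := ENNReal.Tendsto.div_const (((h0.add h0).add h0).add h0)
        (b := ENNReal.ofReal (ε / 2)) (Or.inr (ENNReal.ofReal_pos.2 hε2).ne')
      simpa using this
    obtain ⟨η, h1, h2⟩ := ((ENNReal.tendsto_nhds_zero.1 hlim κ hκ).and
      self_mem_nhdsWithin).exists
    exact ⟨η, h2, h1⟩
  obtain ⟨M, hM1, hM2, hM0, hM⟩ := ((hfull.eventually_lintegral_tail_le hη).and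
    ((hloo.eventually_lintegral_tail_le hη).and ((eventually_ge_atTop 0).and
      (eventually_ge_atTop (ℓ (-ε)))))).exists
  have hfmono : Monotone fun t => max (ℓ (-ε)) (min (ℓ t) M) := fun s t hst =>
    max_le_max le_rfl (min_le_min (hℓ hst) le_rfl)
  obtain ⟨g, L, hg, hfg⟩ := hfmono.exists_lipschitzWith_between (a := ℓ (-ε)) (b := M)
    (fun t => le_max_left _ _) (fun t => max_le hM (min_le_right _ _)) hε
  have hgB : ∀ t, |g t| ≤ max |ℓ (-ε)| |M| := fun t =>
    abs_le_max_abs_abs ((le_max_left _ _).trans (hfg t).1)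
      ((hfg t).2.trans (max_le hM (min_le_right _ _)))
  have habs : LipschitzWith 1 fun t : ℝ => |t| := lipschitzWith_one_norm
  have hshift : LipschitzWith 1 fun t : ℝ => |t| - ε :=
    LipschitzWith.of_dist_le_mul fun s t => by
      simpa [Real.dist_eq] using abs_abs_sub_abs_le s t
  have hlim1 := tendsto_looRiskError_of_lipschitz h𝒜 hZ hstab (hg.comp habs) fun t => hgB _
  have hlim2 := tendsto_looRiskError_of_lipschitz h𝒜 hZ hstab (hg.comp hshift) fun t => hgB _
  have hηpos := ENNReal.ofReal_pos.2 hη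
  filter_upwards [ENNReal.tendsto_nhds_zero.1 hlim1 _ hηpos,
    ENNReal.tendsto_nhds_zero.1 hlim2 _ hηpos, eventually_ge_atTop 2] with n h1 h2 hn
  have hl := (hZ n hn).measurable_looFreshError h𝒜 (⟨n - 1, by omega⟩ : Fin n)
  refine ((hZ n hn).measure_compl_sandwich_le (by omega) h𝒜 hℓ hε hM hg.continuous.measurable
    (g' := fun t => g (t - ε)) (hg.continuous.measurable.comp (measurable_id.sub_const ε))
    (fun t => (hfg t).1) (fun t => (hfg t).2) (fun t => (hfg (t - ε)).1)
    (fun t => by simpa using (hfg (t - ε)).2) ENNReal.ofReal_ne_top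
    ((lintegral_lossExcess_le ((hZ n hn).measurable_freshError h𝒜) hℓ hM0).trans (hM1 n hn))
    ((lintegral_lossExcess_le hl hℓ hM0).trans (hM2 n hn))).trans (le_trans ?_ hηκ)
  gcongr
  exacts [h1, h2]

end Sandwich

theorem mainTheorem10
    (𝒜 : PredAlg) (h𝒜 : 𝒜.IsMeasurable)
    (p : ℕ → ℕ) (law : ∀ n, Measure (Obs (p n)))
    (Ω : ℕ → Type*) [∀ n, MeasurableSpace (Ω n)]
    (P : ∀ n, Measure (Ω n)) [∀ n, IsProbabilityMeasure (P n)]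
    (Z : ∀ n, Fin (n + 1) → Ω n → Obs (p n))
    (hZ : ∀ n, 2 ≤ n → IsIIDSample (Z n) (law n) (P n)) :
    -- sandwich bound for the conditional risk
    (∀ ℓ : ℝ → ℝ, Monotone ℓ →
      IsOutOfSampleStable 𝒜 P Z →
      StochBounded P (fun n ω => newResponse (Z n) ω - fullPred 𝒜 (Z n) ω) →
      UnifIntegrableSeq P (fun n ω => ℓ |newResponse (Z n) ω - fullPred 𝒜 (Z n) ω|) →
      UnifIntegrableSeq P (fun n ω => ℓ |newResponse (Z n) ω - looPred 𝒜 (Z n) (n - 1) ω|) →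
      ∀ ε : ℝ, 0 < ε → Tendsto
        (fun n : ℕ => P n {ω |
          (1 / (n : ℝ)) * ∑ i : Fin n, ℓ (|looResidual 𝒜 (Z n) i ω| - ε) - ε
            ≤ ((P n)[fun ω' => ℓ |newResponse (Z n) ω' - fullPred 𝒜 (Z n) ω'| |
                trainingSigma (Z n)]) ω ∧
          ((P n)[fun ω' => ℓ |newResponse (Z n) ω' - fullPred 𝒜 (Z n) ω'| |
                trainingSigma (Z n)]) ω
            ≤ (1 / (n : ℝ)) * ∑ i : Fin n, ℓ (|looResidual 𝒜 (Z n) i ω| + ε) + ε})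
        atTop (𝓝 1)) ∧
    -- consistency for the conditional mean-squared prediction error
    (∀ ξ : ℝ, 0 < ξ →
      IsOutOfSampleStable 𝒜 P Z →
      BoundedMoments P (fun n ω => newResponse (Z n) ω - fullPred 𝒜 (Z n) ω) (2 + ξ) →
      BoundedMoments P
        (fun n ω => newResponse (Z n) ω - looPred 𝒜 (Z n) (n - 1) ω) (2 + ξ) →
      Tendsto
        (fun n : ℕ => ∫⁻ ω,
          ‖((P n)[fun ω' => (newResponse (Z n) ω' - fullPred 𝒜 (Z n) ω') ^ 2 |
                trainingSigma (Z n)]) ω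
            - (1 / (n : ℝ)) * ∑ i : Fin n, (looResidual 𝒜 (Z n) i ω) ^ 2‖ₑ ∂(P n))
        atTop (𝓝 0)) ∧
    -- consistency for the conditional misclassification error
    (∀ K : ℕ,
      𝒜.IsSymmetric →
      (∀ n, 2 ≤ n → ∀ᵐ ω ∂(P n),
        (∃ k : ℕ, 1 ≤ k ∧ k ≤ K ∧ newResponse (Z n) ω = k) ∧
        (∃ k : ℕ, 1 ≤ k ∧ k ≤ K ∧ fullPred 𝒜 (Z n) ω = k) ∧
        (∃ k : ℕ, 1 ≤ k ∧ k ≤ K ∧ looPred 𝒜 (Z n) (n - 1) ω = k)) →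
      Tendsto (fun n : ℕ => P n {ω | fullPred 𝒜 (Z n) ω ≠ looPred 𝒜 (Z n) (n - 1) ω})
        atTop (𝓝 0) →
      Tendsto
        (fun n : ℕ => ∫⁻ ω,
          ‖((P n)[Set.indicator {ω' | newResponse (Z n) ω' ≠ fullPred 𝒜 (Z n) ω'}
                (fun _ => (1 : ℝ)) | trainingSigma (Z n)]) ω
            - (1 / (n : ℝ)) * ∑ i : Fin n,
                Set.indicator {ω' | looResidual 𝒜 (Z n) i ω' ≠ 0}
                  (fun _ => (1 : ℝ)) ω‖ₑ ∂(P n))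
        atTop (𝓝 0)) := by
  refine ⟨fun ℓ hℓ hstab _ hfull hloo ε hε => ?_, fun ξ hξ hstab hfull hloo => ?_,
    fun K hsymm _ h => ?_⟩
  · exact tendsto_measure_sandwich h𝒜 hZ hstab hℓ hfull hloo hε
  · exact tendsto_looRiskError_sq h𝒜 hZ hstab hξ hfull hloo
  · have h01 : ∀ n, Set.indicator {ω' | newResponse (Z n) ω' ≠ fullPred 𝒜 (Z n) ω'}
        (fun _ => (1 : ℝ)) = fun ω' => zeroOneLoss (newResponse (Z n) ω' - fullPred 𝒜 (Z n) ω') :=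
      fun n => funext fun ω' => by
        simp only [zeroOneLoss, Set.indicator_apply, Set.mem_ofPred_eq, ne_eq, sub_eq_zero]
    have hres : ∀ n (i : Fin n) ω, Set.indicator {ω' | looResidual 𝒜 (Z n) i ω' ≠ 0}
        (fun _ => (1 : ℝ)) ω = zeroOneLoss (looResidual 𝒜 (Z n) i ω) := fun n i ω => by
      simp only [zeroOneLoss, Set.indicator_apply, Set.mem_ofPred_eq]
    simp_rw [h01, hres]
    exact tendsto_looRiskError_zeroOneLoss h𝒜 hsymm hZ h
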